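/- Let $k$ be an algebraically closed field, and let $1\le m\le n$ be integers. For $r\ge 1$ let $\nu_r:\mathbb{P}^1\to\mathbb{P}^r$, $[x:y]\mapsto[x^r:x^{r-1}y:\cdots:y^r]$, be the Veronese embedding over $k$, and let $\mathbb{G}(r-2,r)$ be the Grassmannian of $(r-2)$-dimensional linear subspaces of $\mathbb{P}^r$ with its Zariski topology (for $r=1$ it is the single point $\{\varnothing\}$). For $W\in\mathbb{G}(r-2,r)$ defined by two independent linear equations $L_0=L_1=0$, let $\pi_W\nu_r=[L_0:L_1]\circ\nu_r:\mathbb{P}^1\to\mathbb{P}^1$ be the projection of the rational normal curve from $W$ (extended to a morphism on all of $\mathbb{P}^1$); it is determined by $W$ up to automorphisms of the target $\mathbb{P}^1$. Its degree is the degree of the associated extension of function fields. Put $$\mathfrak{X}_{n,m}:=\{W\in\mathbb{G}(n-2,n):\deg(\pi_W\nu_n)=m\}.$$ For every $W\in\mathfrak{X}_{n,m}$ there is a unique $\Phi_{n,m}(W)\in\mathbb{G}(m-2,m)$ such that $\pi_{\Phi_{n,m}(W)}\nu_m=\pi_W\nu_n$ modulo automorphisms of the target $\mathbb{P}^1$,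 and the resulting map $\Phi_{n,m}:\mathfrak{X}_{n,m}\to\mathbb{G}(m-2,m)$ is a morphism. Moreover: 1. every nonempty fiber of $\Phi_{n,m}$ is irreducible and of dimension $n-m$; 2. $\Phi_{n,m}$ is injective if and only if $n=m$; 3. $\dim\mathfrak{X}_{n,m}=n+m-2$. -/

import Mathlib

open scoped Matrix IntermediateField

noncomputable section

/-- The Zariski topology on the affine space `σ → k`: the closed sets are the common zero loci of
sets of polynomials (the topology induced from the spectrum of the polynomial ring). -/
@[reducible] def zariskiTopology (k : Type*) [Field k] (σ : Type*) : TopologicalSpace (σ → k) :=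
  TopologicalSpace.induced
    (MvPolynomial.pointToPoint (k := k) (K := k) (σ := σ)) inferInstance

/-- The Grassmannian `𝔾(n-2, n)` of `(n-2)`-dimensional linear subspaces of `ℙⁿ`, that is, of linear
subspaces of codimension two of `k^(n+1)`. (For `n = 1` it is the one point set `{∅}`.) -/
def Gr (k : Type*) [Field k] (n : ℕ) : Type _ :=
  {W : Submodule k (Fin (n + 1) → k) // Module.finrank k W + 2 = n + 1}

/-- A pair of linearly independent linear forms `L₀, L₁` in `x₀, …, xₙ`, given by the rows of a
`2 × (n+1)` matrix. -/
def Frame (k : Type*) [Field k] (n : ℕ) : Type _ :=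
  {A : Matrix (Fin 2) (Fin (n + 1)) k // LinearIndependent k A.row}

namespace Frame

variable {k : Type*} [Field k] {n : ℕ}

/-- The `2(n+1)` coefficients of a pair of linear forms. -/
def coeffs (A : Frame k n) : Fin 2 × Fin (n + 1) → k := fun p => A.1 p.1 p.2

/-- Pairs of independent linear forms carry the subspace topology of the Zariski topology on the
affine space of all pairs of linear forms. -/
instance : TopologicalSpace (Frame k n) :=
  TopologicalSpace.induced coeffs (zariskiTopology k (Fin 2 × Fin (n + 1)))

/-- The linear subspace `{L₀ = L₁ = 0}` defined by a pair of independent linear forms. -/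
def center (A : Frame k n) : Gr k n :=
  ⟨LinearMap.ker A.1.mulVecLin, by
    have h := A.1.mulVecLin.finrank_range_add_finrank_ker
    have hr : Module.finrank k (LinearMap.range A.1.mulVecLin) = 2 := by
      have := A.2.rank_matrix
      rwa [Fintype.card_fin] at this
    rw [hr, Module.finrank_fin_fun] at h
    omega⟩

end Frame

/-- The Zariski topology of the Grassmannian: the Grassmannian is the quotient of the space of pairs
of independent linear forms by the action of `GL₂`, with the quotient topology. -/
instance {k : Type*} [Field k] {n : ℕ} : TopologicalSpace (Gr k n) :=
  TopologicalSpace.coinduced Frame.center inferInstance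

/-- The Veronese embedding `ν_n [x : y] = [xⁿ : xⁿ⁻¹ y : ⋯ : x yⁿ⁻¹ : yⁿ]` in coordinates. -/
def veronese {R : Type*} [CommRing R] (n : ℕ) (x y : R) : Fin (n + 1) → R :=
  fun i => x ^ (n - (i : ℕ)) * y ^ (i : ℕ)

namespace Frame

variable {k : Type*} [Field k] {n : ℕ}

/-- The composition `π_W ∘ ν_n = [L₀ : L₁] ∘ ν_n : ℙ¹ → ℙ¹`, where `L₀, L₁` are defining equations
of `W`, as an element `L₀(ν_n(t, 1)) / L₁(ν_n(t, 1))` of the function field `k(t)` of `ℙ¹`. -/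
def projection (A : Frame k n) : RatFunc k :=
  (A.1.map RatFunc.C *ᵥ veronese n RatFunc.X 1) 0 /
    (A.1.map RatFunc.C *ᵥ veronese n RatFunc.X 1) 1

/-- The degree of the morphism `f = [L₀ : L₁] ∘ ν_n : ℙ¹ → ℙ¹`, i.e. the degree of the extension of
function fields `f^* k(ℙ¹) = k(f) ⊆ k(t)`. -/
def degree (A : Frame k n) : ℕ :=
  Module.finrank k⟮A.projection⟯ (RatFunc k)

end Frame

/-- The locus `𝔛_{n,m}` of all `W ∈ 𝔾(n-2, n)` with `deg (π_W ∘ ν_n) = m`. The degree does not depend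
on the defining equations of `W`, since another choice changes `π_W` by an automorphism of `ℙ¹`. -/
def degreeLocus (k : Type*) [Field k] (n m : ℕ) : Set (Gr k n) :=
  {W | ∃ A : Frame k n, A.center = W ∧ A.degree = m}

/-- `f` and `g` are equal modulo automorphisms of (the target) `ℙ¹`: `g = (a f + b) / (c f + d)`
with `ad - bc ≠ 0`. -/
def EqModAut {k : Type*} [Field k] (f g : RatFunc k) : Prop :=
  ∃ M : GL (Fin 2) k,
    g = (RatFunc.C (M 0 0) * f + RatFunc.C (M 0 1)) /
      (RatFunc.C (M 1 0) * f + RatFunc.C (M 1 1))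

/-- `π_V ∘ ν_m = π_W ∘ ν_n` modulo automorphisms of `ℙ¹`. -/
def SameProjection {k : Type*} [Field k] {n m : ℕ} (W : Gr k n) (V : Gr k m) : Prop :=
  ∃ (A : Frame k n) (B : Frame k m), A.center = W ∧ B.center = V ∧
    EqModAut A.projection B.projection

/-- `f : X → 𝔾(m-2, m)`, with `X ⊆ 𝔾(n-2, n)`, is a morphism: Zariski locally on `X`, a pair of
defining equations of `f W` is given by polynomials in the coefficients of a pair of defining
equations of `W`. -/
def IsRegularMap {k : Type*} [Field k] {n m : ℕ} {X : Set (Gr k n)} (f : X → Gr k m) : Prop :=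
  ∀ A : Frame k n, A.center ∈ X →
    ∃ (D : MvPolynomial (Fin 2 × Fin (n + 1)) k)
      (F : Fin 2 → Fin (m + 1) → MvPolynomial (Fin 2 × Fin (n + 1)) k),
      MvPolynomial.eval A.coeffs D ≠ 0 ∧
      ∀ (A' : Frame k n) (hA' : A'.center ∈ X), MvPolynomial.eval A'.coeffs D ≠ 0 →
        ∃ B : Frame k m, (∀ r j, B.1 r j = MvPolynomial.eval A'.coeffs (F r j)) ∧
          B.center = f ⟨A'.center, hA'⟩

end

noncomputable section

open Topology TopologicalSpace

/-! A center `W` is a pencil of binary forms of degree n, up to `GL₂`. Let G be the greatest common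
factor of the pencil; dividing by G leaves a base point free pencil, and the degree of the
projection is the degree of the forms in this quotient (`Factors.degree_eq`,
`exists_factors_of_degree_eq`). With d = n - m, the members of the degree locus are therefore
exactly the products G·B, with G a nonzero form of degree d and B a base point free pencil of degree
m. The pencil determines G up to a scalar and B up to `GL₂` (`Factors.unique`). Hence the locus is
ℙᵈ × U, with U the locus of base point free pencils in 𝔾(m-2, m), and Φ is the second projection.
Its nonempty fibers are copies of ℙᵈ, it is injective exactly when d = 0, and the dimension is d +
2(m - 1) = n + m - 2.

The work lies in making this product decomposition compatible with the Zariski quotient topology.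
Multiplication (G, B) ↦ G·B is polynomial (`continuous_ofPencilData`). In the other direction, B and
then G solve linear systems whose solution space is a line, so Cramer's rule makes them polynomial
in the pencil, locally and up to scalars (`exists_algebraic_kernel_vector`,
`Factors.exists_algebraic`). Normalising one coefficient of G and one 2 × 2 minor of B gives open
charts that are homeomorphic to open parts of coordinate subspaces
(`topologicalKrullDim_chart_image`, `chart_image_univ`, `chart_image_fiber`), whose dimension is
computed by `topologicalKrullDim_coordSlice`. -/

theorem isIrreducible_of_image {X Y : Type*} [TopologicalSpace X] [TopologicalSpace Y] {f : X → Y}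
    (hf : IsInducing f) {s : Set X} (hs : IsIrreducible (f '' s)) : IsIrreducible s := by
  refine ⟨hs.1.of_image, fun U V hU hV ⟨x, hxs, hx⟩ ⟨y, hys, hy⟩ => ?_⟩
  obtain ⟨U, hU', rfl⟩ := hf.isOpen_iff.1 hU
  obtain ⟨V, hV', rfl⟩ := hf.isOpen_iff.1 hV
  obtain ⟨_, ⟨z, hz, rfl⟩, hzU, hzV⟩ := hs.2 U V hU' hV' ⟨f x, Set.mem_image_of_mem f hxs, hx⟩
    ⟨f y, Set.mem_image_of_mem f hys, hy⟩
  exact ⟨z, hz, hzU, hzV⟩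

/-! ### Zariski topology of affine space: continuity, irreducibility, dimension of coordinate
slices. -/

section Zariski

attribute [local instance] zariskiTopology

variable {k : Type*} [Field k] {σ τ : Type*}

theorem mem_basicOpen_pointToPoint (h : MvPolynomial σ k) (x : σ → k) :
    MvPolynomial.pointToPoint x ∈ PrimeSpectrum.basicOpen h ↔ MvPolynomial.eval x h ≠ 0 := by
  rw [PrimeSpectrum.mem_basicOpen, MvPolynomial.pointToPoint, MvPolynomial.mem_vanishingIdeal_iff]
  simp [MvPolynomial.aeval_eq_eval]

theorem isTopologicalBasis_zariski :
    IsTopologicalBasis (Set.range fun h : MvPolynomial σ k => {x : σ → k | MvPolynomial.eval x h ≠ 0}) := by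
  have := (PrimeSpectrum.isTopologicalBasis_basic_opens (R := MvPolynomial σ k)).induced
    (MvPolynomial.pointToPoint (k := k) (K := k) (σ := σ))
  convert this using 1
  ext U
  simp only [Set.mem_range, Set.mem_image, exists_exists_eq_and]
  refine exists_congr fun h => Eq.congr_left ?_
  ext x
  exact (mem_basicOpen_pointToPoint h x).symm

theorem isOpen_eval_ne_zero (h : MvPolynomial σ k) : IsOpen {x : σ → k | MvPolynomial.eval x h ≠ 0} :=
  isTopologicalBasis_zariski.isOpen ⟨h, rfl⟩

theorem isClosed_eval_eq_zero (h : MvPolynomial σ k) :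
    IsClosed {x : σ → k | MvPolynomial.eval x h = 0} := by
  have := isOpen_eval_ne_zero h
  rw [← isOpen_compl_iff]
  exact this

variable {X : Type*} [TopologicalSpace X]

/-- Fractions with nowhere vanishing denominators are closed under sums and products, so every
polynomial in the coordinates of `f` is again such a fraction. The preimage of a basic open set is
then the nonvanishing locus of a numerator. -/
theorem continuous_of_rational {c : X → σ → k} (hc : Continuous c) (f : X → τ → k)
    (hf : ∀ t, ∃ P Q : MvPolynomial σ k, ∀ x, MvPolynomial.eval (c x) Q ≠ 0 ∧
      f x t * MvPolynomial.eval (c x) Q = MvPolynomial.eval (c x) P) : Continuous f := by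
  have key : ∀ h : MvPolynomial τ k, ∃ P Q : MvPolynomial σ k, ∀ x,
      MvPolynomial.eval (c x) Q ≠ 0 ∧
      MvPolynomial.eval (f x) h * MvPolynomial.eval (c x) Q = MvPolynomial.eval (c x) P := by
    intro h
    induction h using MvPolynomial.induction_on with
    | C a => exact ⟨MvPolynomial.C a, 1, by simp⟩
    | add p q hp hq =>
      obtain ⟨P, Q, h⟩ := hp
      obtain ⟨P', Q', h'⟩ := hq
      refine ⟨P * Q' + P' * Q, Q * Q', fun x => ⟨?_, ?_⟩⟩
      · simpa using ⟨(h x).1, (h' x).1⟩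
      · simp only [map_add, map_mul, ← (h x).2, ← (h' x).2]
        ring
    | mul_X p t hp =>
      obtain ⟨P, Q, h⟩ := hp
      obtain ⟨P', Q', h'⟩ := hf t
      refine ⟨P * P', Q * Q', fun x => ⟨?_, ?_⟩⟩
      · simpa using ⟨(h x).1, (h' x).1⟩
      · simp only [map_mul, MvPolynomial.eval_X, ← (h x).2, ← (h' x).2]
        ring
  rw [isTopologicalBasis_zariski.continuous_iff]
  rintro _ ⟨h, rfl⟩
  obtain ⟨P, Q, hPQ⟩ := key h
  convert (isOpen_eval_ne_zero P).preimage hc using 1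
  ext x
  simp only [Set.mem_preimage, Set.mem_ofPred_eq, ← (hPQ x).2]
  simp [(hPQ x).1]

theorem continuous_of_polynomial {c : X → σ → k} (hc : Continuous c) (f : X → τ → k)
    (P : τ → MvPolynomial σ k) (hf : ∀ x t, f x t = MvPolynomial.eval (c x) (P t)) :
    Continuous f :=
  continuous_of_rational hc f fun t => ⟨P t, 1, fun x => by simp [hf]⟩

/-- Selecting coordinates, and filling in constants for the others, is continuous. -/
theorem continuous_coords {c : X → σ → k} (hc : Continuous c) (f : X → τ → k)
    (hf : ∀ t, (∃ s, ∀ x, f x t = c x s) ∨ ∃ a, ∀ x, f x t = a) : Continuous f := by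
  have : ∀ t, ∃ P : MvPolynomial σ k, ∀ x, f x t = MvPolynomial.eval (c x) P := by
    intro t
    rcases hf t with ⟨s, h⟩ | ⟨a, h⟩
    · exact ⟨MvPolynomial.X s, by simpa using h⟩
    · exact ⟨MvPolynomial.C a, by simpa using h⟩
  choose P hP using this
  exact continuous_of_polynomial hc f P fun x t => hP t x

instance irreducibleSpace_zariski [Infinite k] : IrreducibleSpace (σ → k) where
  isPreirreducible_univ := by
    rintro U V hU hV ⟨x, -, hx⟩ ⟨y, -, hy⟩
    obtain ⟨_, ⟨f, rfl⟩, hxf, hf⟩ := isTopologicalBasis_zariski.exists_subset_of_mem_open hx hU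
    obtain ⟨_, ⟨g, rfl⟩, hyg, hg⟩ := isTopologicalBasis_zariski.exists_subset_of_mem_open hy hV
    have hf0 : f ≠ 0 := by rintro rfl; simp at hxf
    have hg0 : g ≠ 0 := by rintro rfl; simp at hyg
    have : ∃ z, MvPolynomial.eval z (f * g) ≠ 0 := by
      by_contra! h
      exact mul_ne_zero hf0 hg0 (MvPolynomial.funext fun z => by rw [h z, map_zero])
    obtain ⟨z, hz⟩ := this
    rw [map_mul] at hz
    exact ⟨z, trivial, hf (left_ne_zero_of_mul hz), hg (right_ne_zero_of_mul hz)⟩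
  toNonempty := ⟨0⟩

/-- Affine space carries the topology induced from the prime spectrum, whose dimension is that of
the polynomial ring. -/
theorem topologicalKrullDim_zariski_le [Finite σ] :
    topologicalKrullDim (σ → k) ≤ (Nat.card σ : WithBot ℕ∞) := by
  have : IsInducing (MvPolynomial.pointToPoint (k := k) (K := k) (σ := σ)) := ⟨rfl⟩
  refine this.topologicalKrullDim_le.trans ?_
  rw [PrimeSpectrum.topologicalKrullDim_eq_ringKrullDim,
    MvPolynomial.ringKrullDim_of_isNoetherianRing, ringKrullDim_eq_zero_of_field, zero_add]

/-- The part in `Ω` of the affine subspace through `z` in the directions `J`. -/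
def coordSlice (J : Finset σ) (z : σ → k) (Ω : Set (σ → k)) : Set (σ → k) :=
  {x | (∀ c ∉ J, x c = z c) ∧ x ∈ Ω}

theorem isClosed_coordSlice_univ (J : Finset σ) (z : σ → k) :
    IsClosed (coordSlice J z Set.univ) := by
  have : coordSlice J z Set.univ = ⋂ c, ⋂ (_ : c ∉ J),
      {x | MvPolynomial.eval x (MvPolynomial.X c - MvPolynomial.C (z c)) = 0} := by
    ext x
    simp [coordSlice, sub_eq_zero]
  rw [this]
  exact isClosed_iInter fun c => isClosed_iInter fun _ => isClosed_eval_eq_zero _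

/-- The slice is the image of the open set `r ⁻¹' Ω` under the retraction `r` that resets the
coordinates outside `J` to those of `z`. -/
theorem isIrreducible_coordSlice [Infinite k] (J : Finset σ) {z : σ → k} {Ω : Set (σ → k)}
    (hΩ : IsOpen Ω) (hz : z ∈ Ω) : IsIrreducible (coordSlice J z Ω) := by
  classical
  let r : (σ → k) → σ → k := fun x c => if c ∈ J then x c else z c
  have hr : Continuous r := continuous_coords continuous_id r fun c => by
    by_cases h : c ∈ J
    · exact Or.inl ⟨c, by simp [r, h]⟩
    · exact Or.inr ⟨z c, by simp [r, h]⟩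
  have hrz : r z = z := by ext c; simp [r]
  have himage : coordSlice J z Ω = r '' (r ⁻¹' Ω) := by
    ext x
    constructor
    · rintro ⟨hx, hxΩ⟩
      have : r x = x := by
        ext c
        by_cases h : c ∈ J <;> simp [r, h, hx]
      exact ⟨x, by rwa [Set.mem_preimage, this], this⟩
    · rintro ⟨y, hy, rfl⟩
      exact ⟨fun c hc => by simp [r, hc], hy⟩
  rw [himage]
  refine IsIrreducible.image ⟨⟨z, by rwa [Set.mem_preimage, hrz]⟩, ?_⟩ r hr.continuousOn
  exact (PreirreducibleSpace.isPreirreducible_univ).open_subset (hΩ.preimage hr) (Set.subset_univ _)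

theorem exists_mem_coordSlice_ne [Infinite k] {J : Finset σ} {z : σ → k} {Ω : Set (σ → k)}
    (hΩ : IsOpen Ω) (hz : z ∈ Ω) {s : σ} (hs : s ∈ J) : ∃ x ∈ coordSlice J z Ω, x s ≠ z s := by
  classical
  obtain ⟨b, hb⟩ := exists_ne (z s)
  have h3 := (isIrreducible_coordSlice J (Ω := Set.univ) isOpen_univ (Set.mem_univ z)).2 Ω
    {x | MvPolynomial.eval x (MvPolynomial.X s - MvPolynomial.C (z s)) ≠ 0} hΩ
    (isOpen_eval_ne_zero _) ⟨z, ⟨fun _ _ => rfl, trivial⟩, hz⟩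
    ⟨Function.update z s b, ⟨fun c hc => Function.update_of_ne (by rintro rfl; exact hc hs) _ _,
      trivial⟩, by simpa [sub_eq_zero] using hb⟩
  obtain ⟨x, ⟨hx, -⟩, hxΩ, hxs⟩ := h3
  exact ⟨x, ⟨hx, hxΩ⟩, by simpa [sub_eq_zero] using hxs⟩

theorem topologicalKrullDim_coordSlice_le (J : Finset σ) (z : σ → k) (Ω : Set (σ → k)) :
    topologicalKrullDim (coordSlice J z Ω) ≤ (J.card : WithBot ℕ∞) := by
  classical
  let f : coordSlice J z Ω → J → k := fun x c => x.1 c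
  let g : (J → k) → σ → k := fun y c => if h : c ∈ J then y ⟨c, h⟩ else z c
  have hf : Continuous f := continuous_coords continuous_subtype_val f fun c => Or.inl ⟨c, fun _ => rfl⟩
  have hg : Continuous g := continuous_coords continuous_id g fun c => by
    by_cases h : c ∈ J
    · exact Or.inl ⟨⟨c, h⟩, by simp [g, h]⟩
    · exact Or.inr ⟨z c, by simp [g, h]⟩
  have hgf : g ∘ f = Subtype.val := by
    ext x c
    by_cases h : c ∈ J
    · simp [f, g, h]
    · simp [g, h, x.2.1 c h]
  have : IsInducing f := IsInducing.of_comp hf hg (by rw [hgf]; exact IsInducing.subtypeVal)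
  refine this.topologicalKrullDim_le.trans (topologicalKrullDim_zariski_le.trans ?_)
  simp

/-- Freeing the directions of `J` one at a time gives a flag of irreducible closed slices through
`z`. Each inclusion is strict because the newly freed coordinate can move inside `Ω`
(`exists_mem_coordSlice_ne`). -/
theorem le_topologicalKrullDim_coordSlice [Infinite k] (J : Finset σ) {z : σ → k}
    {Ω : Set (σ → k)} (hΩ : IsOpen Ω) (hz : z ∈ Ω) :
    (J.card : WithBot ℕ∞) ≤ topologicalKrullDim (coordSlice J z Ω) := by
  classical
  let e := J.equivFin.symm
  let K : Fin (J.card + 1) → Finset σ := fun i =>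
    (Finset.univ.filter fun j : Fin J.card => j.castSucc < i).image fun j => (e j : σ)
  have hKJ : ∀ i, K i ⊆ J := by
    intro i c hc
    simp only [K, Finset.mem_image] at hc
    obtain ⟨j, -, rfl⟩ := hc
    exact (e j).2
  have hKmono : ∀ i i', i ≤ i' → K i ⊆ K i' := by
    intro i i' h
    refine Finset.image_subset_image fun j hj => ?_
    simp only [Finset.mem_filter, Finset.mem_univ, true_and] at hj ⊢
    exact hj.trans_le h
  have hKnot : ∀ j : Fin J.card, (e j : σ) ∉ K j.castSucc := by
    intro j hj
    simp only [K, Finset.mem_image, Finset.mem_filter, Finset.mem_univ, true_and] at hj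
    obtain ⟨j', hlt, he⟩ := hj
    rw [e.injective (Subtype.ext he)] at hlt
    exact lt_irrefl _ hlt
  have hKmem : ∀ j : Fin J.card, (e j : σ) ∈ K j.succ := by
    intro j
    simp only [K, Finset.mem_image, Finset.mem_filter, Finset.mem_univ, true_and]
    exact ⟨j, Fin.castSucc_lt_succ, rfl⟩
  let S := coordSlice J z Ω
  have himg : ∀ i, (Subtype.val : S → σ → k) '' (Subtype.val ⁻¹' coordSlice (K i) z Set.univ) =
      coordSlice (K i) z Ω := by
    intro i
    rw [Subtype.image_preimage_coe]
    ext x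
    constructor
    · rintro ⟨⟨-, h2⟩, h3, -⟩
      exact ⟨h3, h2⟩
    · rintro ⟨h1, h2⟩
      exact ⟨⟨fun c hc => h1 c fun h => hc (hKJ i h), h2⟩, h1, trivial⟩
  let Z : Fin (J.card + 1) → IrreducibleCloseds S := fun i =>
    { carrier := Subtype.val ⁻¹' coordSlice (K i) z Set.univ
      isIrreducible' := by
        have h := isIrreducible_coordSlice (K i) hΩ hz
        rw [← himg i] at h
        exact isIrreducible_of_image IsInducing.subtypeVal h
      isClosed' := (isClosed_coordSlice_univ _ _).preimage continuous_subtype_val }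
  have hZ : ∀ j : Fin J.card, Z j.castSucc < Z j.succ := by
    intro j
    refine lt_of_le_of_ne ?_ ?_
    · intro x hx
      exact ⟨fun c hc => hx.1 c fun h => hc (hKmono _ _ (Fin.castSucc_lt_succ).le h), trivial⟩
    · intro heq
      obtain ⟨x, hx, hne⟩ := exists_mem_coordSlice_ne hΩ hz (hKmem j)
      rw [← himg] at hx
      obtain ⟨y, hy, rfl⟩ := hx
      have : y ∈ (Z j.succ : Set S) := hy
      rw [← heq] at this
      exact hne (this.1 _ (hKnot j))
  let p : LTSeries (IrreducibleCloseds S) := ⟨J.card, Z, hZ⟩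
  exact Order.LTSeries.length_le_krullDim p

theorem topologicalKrullDim_coordSlice [Infinite k] (J : Finset σ) {z : σ → k}
    {Ω : Set (σ → k)} (hΩ : IsOpen Ω) (hz : z ∈ Ω) :
    topologicalKrullDim (coordSlice J z Ω) = (J.card : WithBot ℕ∞) :=
  (topologicalKrullDim_coordSlice_le J z Ω).antisymm (le_topologicalKrullDim_coordSlice J hΩ hz)

end Zariski

/-! ### Krull dimension is local. -/

section Dimension

variable {X Y : Type*} [TopologicalSpace X] [TopologicalSpace Y]

theorem topologicalKrullDim_le_of_open_cover {d : WithBot ℕ∞}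
    (h : ∀ x : X, ∃ U : Set X, IsOpen U ∧ x ∈ U ∧ topologicalKrullDim U ≤ d) :
    topologicalKrullDim X ≤ d := by
  refine iSup_le fun p => ?_
  obtain ⟨x, hx⟩ := p.head.isIrreducible.nonempty
  obtain ⟨U, hU, hxU, hd⟩ := h x
  refine le_trans ?_ hd
  -- A point of the smallest member lies in every member, so the whole chain meets `U`; irreducible
  -- closed sets meeting `U` correspond to those of `U`.
  let q : LTSeries {V : IrreducibleCloseds X | ((Subtype.val : U → X) ⁻¹' V).Nonempty} :=
    ⟨p.length, fun i => ⟨p i, ⟨⟨x, hxU⟩, p.head_le i hx⟩⟩, fun i => p.step i⟩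
  exact (Order.LTSeries.length_le_krullDim q).trans_eq (Order.krullDim_eq_of_orderIso
    (IrreducibleCloseds.orderIsoOfIsOpenEmbedding _ hU.isOpenEmbedding_subtypeVal)).symm

end Dimension
end

noncomputable section

open Polynomial

/-! ### Binary forms as polynomials of bounded degree, and base point free pairs. -/

section Forms

variable {k : Type*} [Field k]

section Ring

variable {R : Type*} [CommRing R]

/-- The dehomogenisation `∑ vⱼ tⁿ⁻ʲ` of the linear form with coefficients `v`, restricted to the
rational normal curve. -/
def formPoly (n : ℕ) : (Fin (n + 1) → R) →ₗ[R] R[X] :=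
  ∑ j : Fin (n + 1), (monomial (n - (j : ℕ))).comp (LinearMap.proj j)

theorem formPoly_apply (n : ℕ) (v : Fin (n + 1) → R) :
    formPoly n v = ∑ j : Fin (n + 1), monomial (n - (j : ℕ)) (v j) := by
  simp [formPoly]

theorem coeff_formPoly {n : ℕ} (v : Fin (n + 1) → R) (e : ℕ) :
    (formPoly n v).coeff e = if e ≤ n then v (Fin.ofNat (n + 1) (n - e)) else 0 := by
  rw [formPoly_apply, finsetSum_coeff]
  simp only [coeff_monomial]
  split_ifs with h
  · rw [Finset.sum_eq_single (Fin.ofNat (n + 1) (n - e))]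
    · rw [if_pos]
      simp only [Fin.val_ofNat]
      rw [Nat.mod_eq_of_lt (by omega)]
      omega
    · intro j _ hj
      rw [if_neg]
      intro hje
      apply hj
      ext
      simp only [Fin.val_ofNat]
      rw [Nat.mod_eq_of_lt (by omega)]
      omega
    · simp
  · exact Finset.sum_eq_zero fun j _ => if_neg (by omega)

theorem coeff_formPoly_sub {n : ℕ} (v : Fin (n + 1) → R) (j : Fin (n + 1)) :
    (formPoly n v).coeff (n - (j : ℕ)) = v j := by
  rw [coeff_formPoly, if_pos (Nat.sub_le _ _)]
  congr 1
  ext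
  simp only [Fin.val_ofNat]
  rw [Nat.mod_eq_of_lt (by omega)]
  omega

theorem natDegree_formPoly_le {n : ℕ} (v : Fin (n + 1) → R) : (formPoly n v).natDegree ≤ n :=
  natDegree_le_iff_coeff_eq_zero.2 fun e he => by rw [coeff_formPoly, if_neg (by omega)]

theorem formPoly_injective (n : ℕ) : Function.Injective (formPoly n : (Fin (n + 1) → R) → R[X]) := by
  intro v w h
  ext j
  rw [← coeff_formPoly_sub v, h, coeff_formPoly_sub]

/-- The coefficients of a polynomial of degree at most `n`, as a form of degree `n`. -/
def polyForm (n : ℕ) (P : R[X]) : Fin (n + 1) → R := fun j => P.coeff (n - (j : ℕ))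

theorem formPoly_polyForm {n : ℕ} {P : R[X]} (hP : P.natDegree ≤ n) :
    formPoly n (polyForm n P) = P := by
  ext e
  rw [coeff_formPoly]
  split_ifs with h
  · simp only [polyForm, Fin.val_ofNat]
    rw [Nat.mod_eq_of_lt (by omega)]
    congr 1
    omega
  · exact (coeff_eq_zero_of_natDegree_lt (by omega)).symm

theorem polyForm_formPoly {n : ℕ} (v : Fin (n + 1) → R) : polyForm n (formPoly n v) = v :=
  funext fun j => coeff_formPoly_sub v j

theorem map_formPoly {S : Type*} [CommRing S] (f : R →+* S) (n : ℕ) (v : Fin (n + 1) → R) :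
    (formPoly n v).map f = formPoly n (fun j => f (v j)) := by
  simp [formPoly_apply, Polynomial.map_sum]

theorem formPoly_eq_sum (n : ℕ) (v : Fin (n + 1) → R) :
    formPoly n v = ∑ j : Fin (n + 1), C (v j) * X ^ (n - (j : ℕ)) := by
  simp only [formPoly_apply, C_mul_X_pow_eq_monomial]

end Ring

/-- The linear combinations of a pair of polynomials given by the rows of a matrix. -/
def pairAct (M : Matrix (Fin 2) (Fin 2) k) (p : Fin 2 → k[X]) : Fin 2 → k[X] :=
  fun r => C (M r 0) * p 0 + C (M r 1) * p 1

/-- A pair of polynomials of degree at most `m` which, as binary forms of degree `m`, have no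
common zero on the projective line. -/
structure BasePointFree (m : ℕ) (p : Fin 2 → k[X]) : Prop where
  natDegree_le : ∀ r, (p r).natDegree ≤ m
  coprime : IsCoprime (p 0) (p 1)
  exists_coeff_ne : ∃ r, (p r).coeff m ≠ 0

theorem linearIndependent_fin_two_iff {V : Type*} [AddCommGroup V] [Module k V] {v : Fin 2 → V} :
    LinearIndependent k v ↔ ∀ s t : k, s • v 0 + t • v 1 = 0 → s = 0 ∧ t = 0 := by
  rw [← LinearIndependent.pair_iff]
  congr!
  ext r
  fin_cases r <;> rfl

namespace BasePointFree

variable {m : ℕ} {p : Fin 2 → k[X]}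

/-- Coprimality makes every syzygy a multiple `f` of the Koszul syzygy (p₁, -p₀). Since some `p r`
has full degree `m`, the degree bound forces `f` to be constant. -/
theorem syzygy (hp : BasePointFree m p) {a b : k[X]} (ha : a.natDegree ≤ m) (hb : b.natDegree ≤ m)
    (h : a * p 0 + b * p 1 = 0) : ∃ c : k, a = C c * p 1 ∧ b = -(C c * p 0) := by
  obtain ⟨u, v, huv⟩ := hp.coprime
  -- Both quotients a / p₁ and -b / p₀ equal this combination, by the Bézout identity.
  set f : k[X] := v * a - u * b with hf
  have h1 : f * p 1 = a := by
    linear_combination (-u) * h + a * huv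
  have h0 : f * p 0 = -b := by
    linear_combination v * h - b * huv
  have hdeg : f.natDegree = 0 := by
    obtain ⟨r, hr⟩ := hp.exists_coeff_ne
    by_cases hf0 : f = 0
    · simp [hf0]
    have hr0 : p r ≠ 0 := by rintro h; simp [h] at hr
    have hle : (f * p r).natDegree ≤ m := by
      fin_cases r
      · simpa [h0] using hb
      · simpa [h1] using ha
    rw [natDegree_mul hf0 hr0] at hle
    have := le_natDegree_of_ne_zero hr
    omega
  obtain ⟨c, hc⟩ : ∃ c, f = C c := ⟨_, eq_C_of_natDegree_eq_zero hdeg⟩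
  exact ⟨c, by rw [← hc, h1], by rw [← hc, h0, neg_neg]⟩

/-- A pair of forms of degree `m` with the same ratio as a base point free one is a scalar multiple
of it: this is the source of all uniqueness statements below. -/
theorem exists_smul (hp : BasePointFree m p) {q : Fin 2 → k[X]} (hq : ∀ r, (q r).natDegree ≤ m)
    (h : q 0 * p 1 = q 1 * p 0) : ∃ c : k, ∀ r, q r = C c * p r := by
  obtain ⟨c, h1, h0⟩ := hp.syzygy (a := q 1) (b := -q 0) (hq 1) (by simpa using hq 0)
    (by linear_combination (-1 : k[X]) * h)
  refine ⟨c, fun r => ?_⟩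
  fin_cases r
  · simpa using h0
  · exact h1

theorem pairAct (hp : BasePointFree m p) {M : Matrix (Fin 2) (Fin 2) k} (hM : M.det ≠ 0) :
    BasePointFree m (pairAct M p) := by
  rw [Matrix.det_fin_two] at hM
  refine ⟨fun r => ?_, ?_, ?_⟩
  · exact natDegree_add_le_of_degree_le ((natDegree_C_mul_le _ _).trans (hp.natDegree_le 0))
      ((natDegree_C_mul_le _ _).trans (hp.natDegree_le 1))
  · obtain ⟨u, v, huv⟩ := hp.coprime
    have hC : C (M 0 0 * M 1 1 - M 0 1 * M 1 0)⁻¹ *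
        (C (M 0 0) * C (M 1 1) - C (M 0 1) * C (M 1 0)) = 1 := by
      rw [← C_mul, ← C_mul, ← C_sub, ← C_mul, inv_mul_cancel₀ hM, C_1]
    refine ⟨C (M 0 0 * M 1 1 - M 0 1 * M 1 0)⁻¹ * (u * C (M 1 1) - v * C (M 1 0)),
      C (M 0 0 * M 1 1 - M 0 1 * M 1 0)⁻¹ * (v * C (M 0 0) - u * C (M 0 1)), ?_⟩
    simp only [_root_.pairAct]
    linear_combination (u * p 0 + v * p 1) * hC + huv
  · by_contra! h
    have h0 := h 0
    have h1 := h 1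
    simp only [_root_.pairAct, coeff_add, coeff_C_mul] at h0 h1
    obtain ⟨r, hr⟩ := hp.exists_coeff_ne
    apply mul_ne_zero hM hr
    fin_cases r
    · simp only [Fin.zero_eta]
      linear_combination M 1 1 * h0 - M 0 1 * h1
    · simp only [Fin.mk_one]
      linear_combination M 0 0 * h1 - M 1 0 * h0

/-- A linear relation is a syzygy with constant coefficients. Comparing coefficients of degree `m ≥
1` shows that it vanishes. -/
theorem linearIndependent (hp : BasePointFree m p) (hm : 1 ≤ m) :
    LinearIndependent k p := by
  rw [linearIndependent_fin_two_iff]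
  intro s t h
  obtain ⟨c, h1, h0⟩ := hp.syzygy (a := C s) (b := C t) (by simp) (by simp)
    (by simpa [smul_eq_C_mul] using h)
  obtain ⟨r, hr⟩ := hp.exists_coeff_ne
  have hc : c = 0 := by
    have key : ∀ u : k, C u = C c * p r → c = 0 := by
      intro u hu
      have := congrArg (fun q => coeff q m) hu
      simp only [coeff_C, coeff_C_mul, if_neg (show m ≠ 0 by omega)] at this
      exact (mul_eq_zero.1 this.symm).resolve_right hr
    fin_cases r
    · exact key (-t) (by rw [C_neg, h0, neg_neg]; rfl)
    · exact key s h1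
  simpa [hc] using And.intro h1 h0

/-- The resultant is taken in formal degrees `m`, `m`, so that it also detects a common zero at
infinity. If one of the leading coefficients is nonzero, it differs from the resultant in the actual
degrees by a nonzero factor; if both vanish, it is zero. -/
theorem iff_resultant (hm : 1 ≤ m) (hdeg : ∀ r, (p r).natDegree ≤ m) :
    BasePointFree m p ↔ resultant (p 0) (p 1) m m ≠ 0 := by
  constructor
  · intro hp
    have hcop := resultant_ne_zero _ _ hp.coprime
    have aux : ∀ q r : k[X], q.natDegree ≤ m → r.natDegree ≤ m → q.coeff m ≠ 0 →
        resultant q r ≠ 0 → resultant q r m m ≠ 0 := by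
      intro q r hq hr hqm hres
      have hqd : q.natDegree = m := hq.antisymm (le_natDegree_of_ne_zero hqm)
      have := resultant_add_right_deg (f := q) (g := r) (m := m) (n := r.natDegree)
        (m - r.natDegree) le_rfl
      rw [Nat.add_sub_cancel' hr] at this
      rw [this]
      rw [hqd] at hres
      exact mul_ne_zero (pow_ne_zero _ hqm) hres
    obtain ⟨r, hr⟩ := hp.exists_coeff_ne
    fin_cases r
    · exact aux _ _ (hdeg 0) (hdeg 1) hr hcop
    · rw [resultant_comm]
      refine mul_ne_zero (pow_ne_zero _ (by simp)) (aux _ _ (hdeg 1) (hdeg 0) hr ?_)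
      exact resultant_ne_zero _ _ hp.coprime.symm
  · intro h
    refine ⟨hdeg, ?_, ?_⟩
    · obtain ⟨a, b, -, -, hab⟩ := exists_mul_add_mul_eq_C_resultant (p 0) (p 1) (hdeg 0) (hdeg 1)
        (Or.inl (by omega))
      refine ⟨C (resultant (p 0) (p 1) m m)⁻¹ * a, C (resultant (p 0) (p 1) m m)⁻¹ * b, ?_⟩
      have : C (resultant (p 0) (p 1) m m)⁻¹ * C (resultant (p 0) (p 1) m m) = (1 : k[X]) := by
        rw [← C_mul, inv_mul_cancel₀ h, C_1]
      rw [← this, ← hab]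
      ring
    · by_contra! hc
      apply h
      have hlt : ∀ r, (p r).natDegree < m := fun r => by
        refine (hdeg r).lt_of_ne fun he => ?_
        have h1 := hc r
        rw [← he, coeff_natDegree, leadingCoeff_eq_zero] at h1
        rw [h1, natDegree_zero] at he
        omega
      exact resultant_eq_zero_of_lt_lt _ _ _ _ (hlt 0) (hlt 1)

end BasePointFree

/-! ### Pencils of forms: the action of `GL₂`, and splitting off the common factor. -/

namespace Frame

variable {n m d : ℕ}

/-- The two polynomials given by the restrictions of the linear forms to the rational normal
curve. -/
def pair (A : Frame k n) : Fin 2 → k[X] := fun r => formPoly n (A.1 r)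

theorem natDegree_pair_le (A : Frame k n) (r : Fin 2) : (A.pair r).natDegree ≤ n :=
  natDegree_formPoly_le _

theorem linearIndependent_pair (A : Frame k n) : LinearIndependent k A.pair :=
  A.2.map' (formPoly n) (LinearMap.ker_eq_bot.2 (formPoly_injective n))

theorem pair_ne_zero (A : Frame k n) (r : Fin 2) : A.pair r ≠ 0 :=
  A.linearIndependent_pair.ne_zero r

theorem pair_injective : Function.Injective (pair : Frame k n → Fin 2 → k[X]) := by
  intro A B h
  refine Subtype.ext (funext fun r => formPoly_injective n (congrFun h r))

/-- The frame given by a pair of linearly independent polynomials. -/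
def ofPair (n : ℕ) (p : Fin 2 → k[X]) (hdeg : ∀ r, (p r).natDegree ≤ n)
    (hp : LinearIndependent k p) : Frame k n :=
  ⟨fun r => polyForm n (p r), by
    refine LinearIndependent.of_comp (formPoly n) ?_
    convert hp using 1
    ext1 r
    exact formPoly_polyForm (hdeg r)⟩

@[simp]
theorem pair_ofPair (p : Fin 2 → k[X]) (hdeg : ∀ r, (p r).natDegree ≤ n)
    (hp : LinearIndependent k p) : (ofPair n p hdeg hp).pair = p :=
  funext fun r => formPoly_polyForm (hdeg r)

theorem projection_eq (A : Frame k n) :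
    A.projection = algebraMap k[X] (RatFunc k) (A.pair 0) / algebraMap k[X] (RatFunc k) (A.pair 1) := by
  have : ∀ r, (A.1.map RatFunc.C *ᵥ veronese n RatFunc.X 1) r =
      algebraMap k[X] (RatFunc k) (A.pair r) := by
    intro r
    simp only [Matrix.mulVec, dotProduct, veronese, pair, formPoly_apply, map_sum, one_pow, mul_one,
      Matrix.map_apply, ← C_mul_X_pow_eq_monomial, map_mul, map_pow, RatFunc.algebraMap_C,
      RatFunc.algebraMap_X]
  rw [projection, this, this]

theorem pair_of_eq_mul {A A' : Frame k n} {M : Matrix (Fin 2) (Fin 2) k} (h : A'.1 = M * A.1) :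
    A'.pair = pairAct M A.pair := by
  ext1 r
  have : A'.1 r = M r 0 • A.1 0 + M r 1 • A.1 1 := by
    ext j
    simp [h, Matrix.mul_apply, Fin.sum_univ_two]
  simp [pair, this, pairAct, smul_eq_C_mul]

theorem eq_mul_of_pair {A A' : Frame k n} {M : Matrix (Fin 2) (Fin 2) k}
    (h : A'.pair = pairAct M A.pair) : A'.1 = M * A.1 := by
  have : ∀ r, A'.1 r = M r 0 • A.1 0 + M r 1 • A.1 1 := by
    intro r
    apply formPoly_injective n
    simpa [pair, pairAct, smul_eq_C_mul] using congrFun h r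
  ext r j
  simp [this, Matrix.mul_apply, Fin.sum_univ_two]

theorem center_eq_of_eq_mul {A A' : Frame k n} {M : Matrix (Fin 2) (Fin 2) k} (hM : M.det ≠ 0)
    (h : A'.1 = M * A.1) : A.center = A'.center := by
  refine Subtype.ext (Submodule.ext fun x => ?_)
  simp only [center, LinearMap.mem_ker, Matrix.mulVecLin_apply, h, ← Matrix.mulVec_mulVec]
  exact ⟨fun hx => by rw [hx, Matrix.mulVec_zero], fun hx => Matrix.eq_zero_of_mulVec_eq_zero hM hx⟩

/-- Each row of `A'` vanishes on the common kernel of the rows of `A`, hence lies in their span. The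
resulting matrix is invertible because the rows of `A'` are independent. -/
theorem exists_eq_mul_of_center_eq {A A' : Frame k n} (h : A.center = A'.center) :
    ∃ M : Matrix (Fin 2) (Fin 2) k, M.det ≠ 0 ∧ A'.1 = M * A.1 := by
  have hker : LinearMap.ker A.1.mulVecLin = LinearMap.ker A'.1.mulVecLin := congrArg Subtype.val h
  have key : ∀ r, ∃ c : Fin 2 → k, ∑ i, c i • A.1 i = A'.1 r := by
    intro r
    have : (LinearMap.proj r).comp A'.1.mulVecLin ∈
        Submodule.span k (Set.range fun i => (LinearMap.proj i).comp A.1.mulVecLin) := by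
      refine mem_span_of_iInf_ker_le_ker fun x hx => ?_
      have hx' : x ∈ LinearMap.ker A.1.mulVecLin := by
        simp only [Submodule.mem_iInf, LinearMap.mem_ker] at hx
        exact LinearMap.mem_ker.2 (funext hx)
      rw [hker, LinearMap.mem_ker] at hx'
      rw [LinearMap.mem_ker, LinearMap.comp_apply, hx', map_zero]
    obtain ⟨c, hc⟩ := (Submodule.mem_span_range_iff_exists_fun k).1 this
    refine ⟨c, ?_⟩
    ext j
    have := LinearMap.congr_fun hc (Pi.single j 1)
    simpa using this
  choose M hM using key
  have hMA : A'.1 = Matrix.of M * A.1 := by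
    ext r j
    simp [← hM r, Matrix.mul_apply]
  refine ⟨Matrix.of M, fun hdet => ?_, hMA⟩
  obtain ⟨v, hv, hv0⟩ := Matrix.exists_vecMul_eq_zero_iff.2 hdet
  have h0 : v ᵥ* A'.1 = 0 := by rw [hMA, ← Matrix.vecMul_vecMul, hv0, Matrix.zero_vecMul]
  have hinj := Matrix.vecMul_injective_iff.2 A'.2
  exact hv (hinj (h0.trans (Matrix.zero_vecMul _).symm))

theorem center_eq_iff {A A' : Frame k n} : A.center = A'.center ↔
    ∃ M : Matrix (Fin 2) (Fin 2) k, M.det ≠ 0 ∧ A'.pair = pairAct M A.pair :=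
  ⟨fun h => (exists_eq_mul_of_center_eq h).imp fun _ hM => ⟨hM.1, pair_of_eq_mul hM.2⟩,
    fun ⟨_, hM, h⟩ => center_eq_of_eq_mul hM (eq_mul_of_pair h)⟩

/-- The pencil spanned by `A` is the product of the base point free pencil spanned by `B` with the
form `G`. -/
structure Factors (A : Frame k (m + d)) (G : k[X]) (B : Frame k m) : Prop where
  basePointFree : BasePointFree m B.pair
  pair_eq : ∀ r, A.pair r = G * B.pair r

namespace Factors

variable {A A' : Frame k (m + d)} {G G' : k[X]} {B B' : Frame k m}

theorem ne_zero (h : A.Factors G B) : G ≠ 0 := by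
  rintro rfl
  exact A.pair_ne_zero 0 (by rw [h.pair_eq, zero_mul])

theorem natDegree_le (h : A.Factors G B) : G.natDegree ≤ d := by
  obtain ⟨r, hr⟩ := h.basePointFree.exists_coeff_ne
  have h1 := A.natDegree_pair_le r
  rw [h.pair_eq, natDegree_mul h.ne_zero (B.pair_ne_zero r)] at h1
  have := le_natDegree_of_ne_zero hr
  omega

/-- The factorisation of a pencil is unique up to scalars. -/
theorem unique (h : A.Factors G B) (h' : A'.Factors G' B') (hc : A.center = A'.center) :
    B.center = B'.center ∧ ∃ a : k, a ≠ 0 ∧ G' = C a * G := by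
  obtain ⟨M, hM, hMA⟩ := center_eq_iff.1 hc
  have hpr : ∀ r, G' * B'.pair r = G * pairAct M B.pair r := by
    intro r
    rw [← h'.pair_eq, hMA]
    simp only [pairAct, h.pair_eq]
    ring
  -- Cancelling G·G' shows that `B'` and `M · B` have the same ratio, so they are proportional by a
  -- constant.
  obtain ⟨c, hcB⟩ := (h.basePointFree.pairAct hM).exists_smul (q := B'.pair) B'.natDegree_pair_le (by
    apply mul_left_cancel₀ (mul_ne_zero h.ne_zero h'.ne_zero)
    linear_combination G * pairAct M B.pair 1 * hpr 0 - G * pairAct M B.pair 0 * hpr 1)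
  have hc0 : c ≠ 0 := by
    rintro rfl
    exact B'.pair_ne_zero 0 (by simp [hcB])
  refine ⟨center_eq_iff.2 ⟨c • M, by simp [hc0, hM], ?_⟩, c⁻¹, inv_ne_zero hc0, ?_⟩
  · ext1 r
    rw [hcB]
    simp only [pairAct, Matrix.smul_apply, smul_eq_mul, C_mul]
    ring
  · have h0 : pairAct M B.pair 0 ≠ 0 := by
      intro h0
      exact B'.pair_ne_zero 0 (by rw [hcB, h0, mul_zero])
    apply mul_right_cancel₀ (mul_ne_zero (C_ne_zero.2 hc0) h0)
    have hCC : C c⁻¹ * C c = (1 : k[X]) := by rw [← C_mul, inv_mul_cancel₀ hc0, C_1]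
    have := hpr 0
    rw [hcB] at this
    linear_combination this - G * pairAct M B.pair 0 * hCC

end Factors

theorem exists_num_denom_mul (P Q : k[X]) (hQ : Q ≠ 0) :
    ∃ h, P = (algebraMap k[X] (RatFunc k) P / algebraMap k[X] (RatFunc k) Q).num * h ∧
      Q = (algebraMap k[X] (RatFunc k) P / algebraMap k[X] (RatFunc k) Q).denom * h := by
  set f := algebraMap k[X] (RatFunc k) P / algebraMap k[X] (RatFunc k) Q with hf
  have hQ' : algebraMap k[X] (RatFunc k) Q ≠ 0 := by simpa using hQ
  have hd : algebraMap k[X] (RatFunc k) f.denom ≠ 0 := by simpa using f.denom_ne_zero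
  have h1 : P * f.denom = f.num * Q := by
    apply RatFunc.algebraMap_injective k
    rw [map_mul, map_mul]
    have := f.num_div_denom
    rw [hf, div_eq_div_iff hd hQ', ← hf] at this
    exact this.symm
  obtain ⟨h, hh⟩ := f.isCoprime_num_denom.symm.dvd_of_dvd_mul_left (Dvd.intro_left _ h1)
  refine ⟨h, ?_, hh⟩
  apply mul_right_cancel₀ f.denom_ne_zero
  rw [h1]
  nth_rewrite 1 [hh]
  ring

/-- The factor `G` cancels in the quotient, and the coprime pair `B` is its reduced fraction up to a
unit. The degree of the function field extension is then the larger of the two polynomial degrees,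
which is `m` because a coefficient of degree `m` survives. -/
theorem Factors.degree_eq {A : Frame k (m + d)} {G : k[X]} {B : Frame k m} (h : A.Factors G B) :
    A.degree = m := by
  have hpr : A.projection = algebraMap k[X] (RatFunc k) (B.pair 0) /
      algebraMap k[X] (RatFunc k) (B.pair 1) := by
    rw [projection_eq, h.pair_eq, h.pair_eq, map_mul, map_mul, mul_div_mul_left]
    simpa using h.ne_zero
  rw [degree, RatFunc.finrank_eq_max_natDegree, hpr]
  obtain ⟨f, h0, h1⟩ := exists_num_denom_mul (B.pair 0) (B.pair 1) (B.pair_ne_zero 1)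
  have hf : IsUnit f := h.basePointFree.coprime.isUnit_of_dvd' (Dvd.intro_left _ h0.symm)
    (Dvd.intro_left _ h1.symm)
  have hmax : max (B.pair 0).natDegree (B.pair 1).natDegree = m := by
    refine (max_le (B.natDegree_pair_le 0) (B.natDegree_pair_le 1)).antisymm ?_
    obtain ⟨r, hr⟩ := h.basePointFree.exists_coeff_ne
    have := le_natDegree_of_ne_zero hr
    fin_cases r
    · exact this.trans (le_max_left _ _)
    · exact this.trans (le_max_right _ _)
  obtain ⟨c, hc, rfl⟩ := Polynomial.isUnit_iff.1 hf
  have e0 := (congrArg natDegree h0).trans (natDegree_mul_C hc.ne_zero)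
  have e1 := (congrArg natDegree h1).trans (natDegree_mul_C hc.ne_zero)
  rwa [e0, e1] at hmax

/-- The reduced numerator and denominator of the projection serve as base point free pencil: their
larger degree is exactly `m`, which excludes a common zero at infinity. -/
theorem exists_factors_of_degree_eq (hm : 1 ≤ m) {A : Frame k (m + d)} (h : A.degree = m) :
    ∃ G B, A.Factors G B := by
  rw [degree, RatFunc.finrank_eq_max_natDegree] at h
  obtain ⟨f, h0, h1⟩ := exists_num_denom_mul (A.pair 0) (A.pair 1) (A.pair_ne_zero 1)
  rw [← projection_eq] at h0 h1
  have hcoeff : ∀ q : k[X], q.natDegree = m → q.coeff m ≠ 0 := by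
    rintro q rfl
    rw [coeff_natDegree, leadingCoeff_ne_zero]
    rintro rfl
    simp at hm
  have hbpf : BasePointFree m ![A.projection.num, A.projection.denom] := by
    refine ⟨?_, A.projection.isCoprime_num_denom, ?_⟩
    · rw [Fin.forall_fin_two]
      exact ⟨(le_max_left _ _).trans h.le, (le_max_right _ _).trans h.le⟩
    · rw [Fin.exists_fin_two]
      rcases max_choice A.projection.num.natDegree A.projection.denom.natDegree with h' | h'
      · exact Or.inl (hcoeff _ (h'.symm.trans h))
      · exact Or.inr (hcoeff _ (h'.symm.trans h))
  refine ⟨f, ofPair m _ hbpf.natDegree_le (hbpf.linearIndependent hm), by rwa [pair_ofPair], ?_⟩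
  rw [Fin.forall_fin_two, pair_ofPair]
  exact ⟨h0.trans (mul_comm _ _), h1.trans (mul_comm _ _)⟩

end Frame

end Forms
end

noncomputable section

open Polynomial

/-! ### Solving linear systems with polynomial parameters by Cramer's rule. -/

section LinearSystems

variable {k : Type*} [Field k] {R : Type*} [CommRing R] [Algebra k R]

/-- Where the kernel of a matrix with variable coefficients is at most a line, it is spanned by a
vector depending algebraically on the parameters. -/
theorem exists_algebraic_kernel_vector {r c : Type*} [Fintype r] [Fintype c] [DecidableEq r]
    [DecidableEq c] (M : Matrix r c R)
    (ev₀ : R →ₐ[k] k) {w₀ : c → k} (hw₀ : w₀ ≠ 0)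
    (h₀ : ∀ w, M.map ev₀ *ᵥ w = 0 → ∃ a : k, w = a • w₀) :
    ∃ (D : R) (v : c → R), ev₀ D ≠ 0 ∧ ∀ ev : R →ₐ[k] k, ev D ≠ 0 →
      ∀ w, M.map ev *ᵥ w = 0 → ∃ a : k, w = a • fun i => ev (v i) := by
  obtain ⟨c₀, hc₀⟩ := Function.ne_iff.1 hw₀
  -- Appending the coordinate `c₀`, where `w₀` does not vanish, makes the matrix injective at `ev₀`.
  let row : Matrix Unit c R := Matrix.of fun _ => Pi.single c₀ 1
  let rowk : Matrix Unit c k := Matrix.of fun _ => Pi.single c₀ 1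
  have hrow : ∀ ev : R →ₐ[k] k, row.map ev = rowk := by
    intro ev
    ext i j
    by_cases h : j = c₀
    · subst h; simp [row, rowk]
    · simp [row, rowk, h]
  have hmap : ∀ ev : R →ₐ[k] k, (Matrix.fromRows M row).map ev = Matrix.fromRows (M.map ev) rowk := by
    intro ev
    rw [← hrow ev]
    ext (i | i) j <;> rfl
  obtain ⟨g, hg⟩ := LinearMap.exists_leftInverse_of_injective
    (Matrix.fromRows (M.map ev₀) rowk).mulVecLin (by
      rw [LinearMap.ker_eq_bot']
      intro w hw
      rw [Matrix.mulVecLin_apply, Matrix.fromRows_mulVec] at hw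
      obtain ⟨a, rfl⟩ := h₀ w (funext fun i => congrFun hw (Sum.inl i))
      have h1 := congrFun hw (Sum.inr ())
      simp [rowk, Matrix.mulVec] at h1
      rcases h1 with h1 | h1
      · simp [h1]
      · exact absurd h1 hc₀)
  set L := LinearMap.toMatrix' g with hL
  have hLN : L * Matrix.fromRows (M.map ev₀) rowk = 1 := by
    have := congrArg LinearMap.toMatrix' hg
    rwa [LinearMap.toMatrix'_comp, LinearMap.toMatrix'_id, ← Matrix.toLin'_apply', LinearMap.toMatrix'_toLin'] at this
  let LR : Matrix c (r ⊕ Unit) R := L.map (algebraMap k R)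
  have hLR : ∀ ev : R →ₐ[k] k, LR.map ev = L := by
    intro ev
    ext i j
    simp [LR]
  -- A constant left inverse chosen at `ev₀` turns the system into a square one whose determinant is
  -- 1 there; this determinant is the required `D`.
  let S : Matrix c c R := LR * Matrix.fromRows M row
  have hS : ∀ ev : R →ₐ[k] k, S.map ev = L * Matrix.fromRows (M.map ev) rowk := by
    intro ev
    rw [← hmap, ← hLR ev]
    exact Matrix.map_mul (f := (ev : R →+* k))
  let e : r ⊕ Unit → R := Pi.single (Sum.inr ()) 1
  refine ⟨S.det, S.adjugate *ᵥ (LR *ᵥ e), ?_, fun ev hev w hw => ⟨(ev S.det)⁻¹ * w c₀, ?_⟩⟩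
  · have : ev₀ S.det = (S.map ev₀).det := RingHom.map_det (ev₀ : R →+* k) S
    rw [this, hS, hLN, Matrix.det_one]
    exact one_ne_zero
  · have hdet : ev S.det = (S.map ev).det := RingHom.map_det (ev : R →+* k) S
    have hadj : S.adjugate.map ev = (S.map ev).adjugate := RingHom.map_adjugate (ev : R →+* k) S
    have hv : (fun i => ev ((S.adjugate *ᵥ (LR *ᵥ e)) i)) =
        (S.map ev).adjugate *ᵥ (L *ᵥ Pi.single (Sum.inr ()) 1) := by
      rw [← hadj, ← hLR ev]
      ext i
      rw [show ev ((S.adjugate *ᵥ (LR *ᵥ e)) i) = (ev : R →+* k) ((S.adjugate *ᵥ (LR *ᵥ e)) i) from rfl,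
        RingHom.map_mulVec]
      congr 1
      ext j
      simp only [Function.comp_apply]
      rw [RingHom.map_mulVec]
      congr 1
      ext x
      rcases x with x | x <;> simp [e]
    -- For a kernel vector only the appended row contributes, so inverting `S` leaves `w` no freedom
    -- beyond the scalar `w c₀`.
    have hSw : S.map ev *ᵥ w = w c₀ • (L *ᵥ Pi.single (Sum.inr ()) 1) := by
      rw [hS, ← Matrix.mulVec_mulVec, ← Matrix.mulVec_smul, Matrix.fromRows_mulVec, hw]
      congr 1
      ext x
      rcases x with x | x <;> simp [rowk, Matrix.mulVec]
    have key := congrArg (fun z => (S.map ev).adjugate *ᵥ z) hSw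
    simp only [Matrix.mulVec_mulVec, Matrix.adjugate_mul, Matrix.smul_mulVec, Matrix.one_mulVec,
      Matrix.mulVec_smul, ← hdet] at key
    rw [hv, mul_smul, Matrix.mulVec_mulVec, ← key, smul_smul, inv_mul_cancel₀ hev, one_smul]

/-- Where the linear relations among polynomials with variable coefficients are at most a line,
they are spanned by a relation depending algebraically on the parameters. -/
theorem exists_algebraic_relation {ι : Type*} [Fintype ι] [DecidableEq ι] (Q : ι → R[X])
    (ev₀ : R →ₐ[k] k) {w₀ : ι → k} (hw₀ : w₀ ≠ 0)
    (h₀ : ∀ w : ι → k, ∑ i, C (w i) * (Q i).map (ev₀ : R →+* k) = 0 → ∃ a : k, w = a • w₀) :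
    ∃ (D : R) (v : ι → R), ev₀ D ≠ 0 ∧ ∀ ev : R →ₐ[k] k, ev D ≠ 0 →
      ∀ w : ι → k, ∑ i, C (w i) * (Q i).map (ev : R →+* k) = 0 →
        ∃ a : k, w = a • fun i => ev (v i) := by
  let N := Finset.univ.sup fun i => (Q i).natDegree
  have hN : ∀ i, (Q i).natDegree ≤ N := fun i =>
    Finset.le_sup (f := fun i => (Q i).natDegree) (Finset.mem_univ i)
  let M : Matrix (Fin (N + 1)) ι R := Matrix.of fun e i => (Q i).coeff e
  have hM : ∀ (ev : R →ₐ[k] k) (w : ι → k), M.map ev *ᵥ w = 0 ↔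
      ∑ i, C (w i) * (Q i).map (ev : R →+* k) = 0 := by
    intro ev w
    have hc : ∀ e, (∑ i, C (w i) * (Q i).map (ev : R →+* k)).coeff e =
        ∑ i, ev ((Q i).coeff e) * w i := by
      intro e
      simp [finsetSum_coeff, mul_comm]
    constructor
    · intro h
      ext e
      rw [hc, coeff_zero]
      by_cases he : e < N + 1
      · exact congrFun h ⟨e, he⟩
      · refine Finset.sum_eq_zero fun i _ => ?_
        rw [coeff_eq_zero_of_natDegree_lt (by have := hN i; omega), map_zero, zero_mul]
    · intro h
      ext e
      have := hc e
      rw [h, coeff_zero] at this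
      exact this.symm
  obtain ⟨D, v, hD, hv⟩ := exists_algebraic_kernel_vector M ev₀ hw₀ fun w hw => h₀ w ((hM _ _).1 hw)
  exact ⟨D, v, hD, fun ev hev w hw => hv ev hev w ((hM _ _).2 hw)⟩

end LinearSystems

/-! ### The factors of a pencil depend algebraically on it. -/

section LocalFactorization

variable {k : Type*} [Field k] {n m d : ℕ}

/-- The pair of polynomials of the generic pair of linear forms. -/
def genericPair (k : Type*) [Field k] (n : ℕ) (r : Fin 2) :
    (MvPolynomial (Fin 2 × Fin (n + 1)) k)[X] :=
  formPoly n fun j => MvPolynomial.X (r, j)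

theorem map_genericPair (A : Frame k n) (r : Fin 2) :
    (genericPair k n r).map (MvPolynomial.aeval (R := k) A.coeffs : _ →+* k) = A.pair r := by
  simp [genericPair, map_formPoly, Frame.pair, Frame.coeffs]

namespace Frame.Factors

variable {A₀ : Frame k (m + d)} {G₀ : k[X]} {B₀ : Frame k m}

theorem exists_scalar_of_relation {A : Frame k (m + d)} {G : k[X]} {B : Frame k m}
    (h : A.Factors G B) {w : Fin 2 → Fin (m + 1) → k}
    (hw : formPoly m (w 0) * A.pair 1 = formPoly m (w 1) * A.pair 0) :
    ∃ c : k, ∀ r j, w r j = c * B.1 r j := by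
  obtain ⟨c, hc⟩ := h.basePointFree.exists_smul (q := fun r => formPoly m (w r))
    (fun r => natDegree_formPoly_le _) (by
      apply mul_left_cancel₀ h.ne_zero
      rw [h.pair_eq, h.pair_eq] at hw
      linear_combination hw)
  refine ⟨c, fun r j => ?_⟩
  have : w r = c • B.1 r := formPoly_injective m (by
    rw [map_smul, smul_eq_C_mul]
    exact hc r)
  rw [this]
  rfl

/-- The base point free part of a pencil depends algebraically on the pencil. -/
theorem exists_algebraic_pencil (h₀ : A₀.Factors G₀ B₀) :
    ∃ (D : MvPolynomial (Fin 2 × Fin (m + d + 1)) k)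
      (v : Fin 2 → Fin (m + 1) → MvPolynomial (Fin 2 × Fin (m + d + 1)) k),
      MvPolynomial.eval A₀.coeffs D ≠ 0 ∧ ∀ (A : Frame k (m + d)) (G : k[X]) (B : Frame k m),
        A.Factors G B → MvPolynomial.eval A.coeffs D ≠ 0 →
        ∃ b : k, b ≠ 0 ∧ ∀ r j, MvPolynomial.eval A.coeffs (v r j) = b * B.1 r j := by
  -- These encode the linear system w₀·A₁ = w₁·A₀ for a pair of forms of degree `m`; its solutions
  -- are the multiples of `B`.
  let Q : Fin 2 × Fin (m + 1) → (MvPolynomial (Fin 2 × Fin (m + d + 1)) k)[X] := fun i =>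
    ![genericPair k (m + d) 1, -genericPair k (m + d) 0] i.1 * X ^ (m - (i.2 : ℕ))
  have hQ : ∀ (A : Frame k (m + d)) (w : Fin 2 × Fin (m + 1) → k),
      ∑ i, C (w i) * (Q i).map (MvPolynomial.aeval (R := k) A.coeffs : _ →+* k) =
        formPoly m (fun j => w (0, j)) * A.pair 1 - formPoly m (fun j => w (1, j)) * A.pair 0 := by
    intro A w
    simp only [Q, Fintype.sum_prod_type, Fin.sum_univ_two, Matrix.cons_val_zero, Matrix.cons_val_one,
      Polynomial.map_mul, Polynomial.map_neg, Polynomial.map_pow, Polynomial.map_X, map_genericPair,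
      formPoly_eq_sum, Finset.sum_mul, sub_eq_add_neg, ← Finset.sum_neg_distrib]
    refine congrArg₂ (· + ·) (Finset.sum_congr rfl fun j _ => ?_) (Finset.sum_congr rfl fun j _ => ?_)
    · generalize A.pair 1 = p
      ring
    · generalize A.pair 0 = p
      ring
  have hne : (fun i : Fin 2 × Fin (m + 1) => B₀.1 i.1 i.2) ≠ 0 := fun h =>
    B₀.2.ne_zero 0 (funext fun j => congrFun h (0, j))
  obtain ⟨D, v, hD, hv⟩ := exists_algebraic_relation Q (MvPolynomial.aeval A₀.coeffs) hne
    fun w hw => by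
      rw [hQ, sub_eq_zero] at hw
      obtain ⟨c, hc⟩ := h₀.exists_scalar_of_relation (w := fun r j => w (r, j)) hw
      exact ⟨c, funext fun i => hc i.1 i.2⟩
  refine ⟨D, fun r j => v (r, j), by simpa [MvPolynomial.aeval_eq_eval] using hD,
    fun A G B h hA => ?_⟩
  obtain ⟨a, ha⟩ := hv (MvPolynomial.aeval A.coeffs) (by simpa [MvPolynomial.aeval_eq_eval] using hA)
    (fun i => B.1 i.1 i.2) (by
      rw [hQ, sub_eq_zero, h.pair_eq, h.pair_eq]
      simp only [pair]
      ring)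
  have ha0 : a ≠ 0 := by
    rintro rfl
    exact B.2.ne_zero 0 (funext fun j => by simpa using congrFun ha (0, j))
  refine ⟨a⁻¹, inv_ne_zero ha0, fun r j => ?_⟩
  have := congrFun ha (r, j)
  simp only [Pi.smul_apply, smul_eq_mul, MvPolynomial.aeval_eq_eval] at this
  rw [this, ← mul_assoc, inv_mul_cancel₀ ha0, one_mul]

/-- The base point free part and the base locus of a pencil depend algebraically on the pencil. -/
theorem exists_algebraic (h₀ : A₀.Factors G₀ B₀) :
    ∃ (D : MvPolynomial (Fin 2 × Fin (m + d + 1)) k)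
      (g : Fin (d + 1) → MvPolynomial (Fin 2 × Fin (m + d + 1)) k)
      (v : Fin 2 → Fin (m + 1) → MvPolynomial (Fin 2 × Fin (m + d + 1)) k),
      MvPolynomial.eval A₀.coeffs D ≠ 0 ∧ ∀ (A : Frame k (m + d)) (G : k[X]) (B : Frame k m),
        A.Factors G B → MvPolynomial.eval A.coeffs D ≠ 0 → ∃ a b : k, a ≠ 0 ∧ b ≠ 0 ∧
          (∀ i, MvPolynomial.eval A.coeffs (g i) = a * polyForm d G i) ∧
          ∀ r j, MvPolynomial.eval A.coeffs (v r j) = b * B.1 r j := by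
  obtain ⟨D₁, v, hD₁, hv⟩ := h₀.exists_algebraic_pencil
  -- With a multiple b·B already algebraic, the system g·(b·B₀) = s·A₀ in (g, s) has the line
  -- spanned by (G, b) as its solutions.
  let Q : Fin (d + 1) ⊕ Unit → (MvPolynomial (Fin 2 × Fin (m + d + 1)) k)[X] :=
    Sum.elim (fun i => X ^ (d - (i : ℕ)) * formPoly m (v 0)) fun _ => -genericPair k (m + d) 0
  have hQ : ∀ (A : Frame k (m + d)) (B : Frame k m) (b : k),
      (∀ r j, MvPolynomial.eval A.coeffs (v r j) = b * B.1 r j) → ∀ w : Fin (d + 1) ⊕ Unit → k,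
      ∑ i, C (w i) * (Q i).map (MvPolynomial.aeval (R := k) A.coeffs : _ →+* k) =
        formPoly d (fun j => w (Sum.inl j)) * (C b * B.pair 0) - C (w (Sum.inr ())) * A.pair 0 := by
    intro A B b hb w
    have hmap : (formPoly m (v 0)).map (MvPolynomial.aeval (R := k) A.coeffs : _ →+* k) =
        C b * B.pair 0 := by
      rw [map_formPoly, ← smul_eq_C_mul, pair, ← map_smul]
      congr 1
      ext j
      simpa [MvPolynomial.aeval_eq_eval] using hb 0 j
    simp only [Q, Fintype.sum_sum_type, Sum.elim_inl, Sum.elim_inr, Polynomial.map_mul,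
      Polynomial.map_neg, Polynomial.map_pow, Polynomial.map_X, map_genericPair, hmap,
      formPoly_eq_sum d, Finset.sum_mul, Finset.univ_unique, Finset.sum_singleton, sub_eq_add_neg]
    refine congrArg₂ (· + ·) (Finset.sum_congr rfl fun j _ => ?_) (mul_neg _ _)
    generalize B.pair 0 = p
    ring
  have hGd : ∀ {A : Frame k (m + d)} {G : k[X]} {B : Frame k m}, A.Factors G B → ∀ {b : k}, b ≠ 0 →
      (∀ r j, MvPolynomial.eval A.coeffs (v r j) = b * B.1 r j) → ∀ w : Fin (d + 1) ⊕ Unit → k,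
      ∑ i, C (w i) * (Q i).map (MvPolynomial.aeval (R := k) A.coeffs : _ →+* k) = 0 ↔
        ∃ t : k, w = t • Sum.elim (polyForm d G) fun _ => b := by
    intro A G B h b hb0 hb w
    rw [hQ A B b hb, h.pair_eq]
    constructor
    · intro hw
      have hw' : C b * formPoly d (fun j => w (Sum.inl j)) = C (w (Sum.inr ())) * G := by
        apply mul_right_cancel₀ (B.pair_ne_zero 0)
        linear_combination hw
      refine ⟨w (Sum.inr ()) * b⁻¹, ?_⟩
      have : (fun j => w (Sum.inl j)) = (w (Sum.inr ()) * b⁻¹) • polyForm d G := by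
        apply formPoly_injective d
        rw [map_smul, formPoly_polyForm h.natDegree_le, smul_eq_C_mul, C_mul]
        have hCC : C b⁻¹ * C b = (1 : k[X]) := by rw [← C_mul, inv_mul_cancel₀ hb0, C_1]
        linear_combination C b⁻¹ * hw' - formPoly d (fun j => w (Sum.inl j)) * hCC
      ext (j | j)
      · exact congrFun this j
      · simp [hb0]
    · rintro ⟨t, rfl⟩
      have : (fun j => (t • Sum.elim (polyForm d G) fun _ : Unit => b) (Sum.inl j)) =
          t • polyForm d G := rfl
      rw [this, map_smul, formPoly_polyForm h.natDegree_le, smul_eq_C_mul]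
      simp only [Pi.smul_apply, Sum.elim_inr, smul_eq_mul, C_mul]
      ring
  obtain ⟨b₀, hb₀, hvb₀⟩ := hv A₀ G₀ B₀ h₀ hD₁
  obtain ⟨D₂, u, hD₂, hu⟩ := exists_algebraic_relation Q (MvPolynomial.aeval A₀.coeffs)
    (w₀ := Sum.elim (polyForm d G₀) fun _ => b₀)
    (fun h => hb₀ (congrFun h (Sum.inr ()))) fun w hw => (hGd h₀ hb₀ hvb₀ w).1 hw
  refine ⟨D₁ * D₂, fun i => u (Sum.inl i), v, ?_, fun A G B h hA => ?_⟩
  · rw [map_mul]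
    exact mul_ne_zero hD₁ (by simpa [MvPolynomial.aeval_eq_eval] using hD₂)
  · rw [map_mul] at hA
    obtain ⟨b, hb, hvb⟩ := hv A G B h (left_ne_zero_of_mul hA)
    obtain ⟨a, ha⟩ := hu (MvPolynomial.aeval A.coeffs)
      (by simpa [MvPolynomial.aeval_eq_eval] using right_ne_zero_of_mul hA)
      (Sum.elim (polyForm d G) fun _ => b) ((hGd h hb hvb _).2 ⟨1, (one_smul _ _).symm⟩)
    have ha0 : a ≠ 0 := by
      rintro rfl
      exact hb (by simpa using congrFun ha (Sum.inr ()))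
    refine ⟨a⁻¹, b, inv_ne_zero ha0, hb, fun i => ?_, hvb⟩
    have := congrFun ha (Sum.inl i)
    simp only [Pi.smul_apply, smul_eq_mul, MvPolynomial.aeval_eq_eval, Sum.elim_inl] at this
    rw [this, ← mul_assoc, inv_mul_cancel₀ ha0, one_mul]

end Frame.Factors

end LocalFactorization
end

noncomputable section

open Polynomial Topology TopologicalSpace

/-! ### The quotient topology of the Grassmannian and of the degree locus. -/

section FrameTopology

attribute [local instance] zariskiTopology

variable {k : Type*} [Field k] {n m d : ℕ}

namespace Frame

theorem isInducing_coeffs : IsInducing (coeffs : Frame k n → _) := ⟨rfl⟩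

theorem continuous_coeffs : Continuous (coeffs : Frame k n → _) := isInducing_coeffs.continuous

theorem continuous_center : Continuous (center : Frame k n → Gr k n) := continuous_coinduced_rng

/-- The action of an invertible matrix on pairs of linear forms. -/
def act (M : Matrix (Fin 2) (Fin 2) k) (hM : M.det ≠ 0) (A : Frame k n) : Frame k n :=
  ⟨M * A.1, by
    rw [← Matrix.vecMul_injective_iff]
    have h1 := Matrix.vecMul_injective_iff.2 A.2
    have h2 := Matrix.vecMul_injective_iff_isUnit.2 ((Matrix.isUnit_iff_isUnit_det M).2 hM.isUnit)
    have : (M * A.1).vecMul = A.1.vecMul ∘ M.vecMul := by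
      ext1 v
      simp [Matrix.vecMul_vecMul]
    rw [this]
    exact h1.comp h2⟩

@[simp]
theorem pair_act (M : Matrix (Fin 2) (Fin 2) k) (hM : M.det ≠ 0) (A : Frame k n) :
    (A.act M hM).pair = pairAct M A.pair := pair_of_eq_mul rfl

@[simp]
theorem center_act (M : Matrix (Fin 2) (Fin 2) k) (hM : M.det ≠ 0) (A : Frame k n) :
    (A.act M hM).center = A.center := (center_eq_of_eq_mul hM rfl).symm

theorem continuous_act (M : Matrix (Fin 2) (Fin 2) k) (hM : M.det ≠ 0) :
    Continuous (act M hM : Frame k n → Frame k n) := by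
  rw [isInducing_coeffs.continuous_iff]
  refine continuous_of_polynomial continuous_coeffs _
    (fun t => ∑ s, MvPolynomial.C (M t.1 s) * MvPolynomial.X (s, t.2)) fun A t => ?_
  simp [act, coeffs, Matrix.mul_apply]

/-- The saturation of an open set is the union of its translates under `GL₂`, which act by
homeomorphisms. -/
theorem isOpenMap_center : IsOpenMap (center : Frame k n → Gr k n) := by
  intro U hU
  have : center ⁻¹' (center '' U) =
      ⋃ M : Matrix (Fin 2) (Fin 2) k, ⋃ hM : M.det ≠ 0, act M hM ⁻¹' U := by
    ext A
    simp only [Set.mem_preimage, Set.mem_image, Set.mem_iUnion]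
    constructor
    · rintro ⟨A', hA', h⟩
      obtain ⟨M, hM, hMA⟩ := exists_eq_mul_of_center_eq h.symm
      refine ⟨M, hM, ?_⟩
      rwa [show A.act M hM = A' from Subtype.ext hMA.symm]
    · rintro ⟨M, hM, h⟩
      exact ⟨_, h, center_act M hM A⟩
  rw [isOpen_coinduced, this]
  exact isOpen_iUnion fun M => isOpen_iUnion fun hM => hU.preimage (continuous_act M hM)

/-- The product of a pencil with a form of degree `d`. -/
def mulForm (G : k[X]) (hG : G ≠ 0) (hGd : G.natDegree ≤ d) (B : Frame k m) : Frame k (m + d) :=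
  ofPair (m + d) (fun r => G * B.pair r)
    (fun r => natDegree_mul_le.trans (by have := B.natDegree_pair_le r; omega)) <| by
      have hinj : Function.Injective (LinearMap.mulLeft k G) := fun p q h =>
        mul_left_cancel₀ hG (by simpa using h)
      exact B.linearIndependent_pair.map' (LinearMap.mulLeft k G) (LinearMap.ker_eq_bot.2 hinj)

@[simp]
theorem pair_mulForm (G : k[X]) (hG : G ≠ 0) (hGd : G.natDegree ≤ d) (B : Frame k m) :
    (B.mulForm G hG hGd).pair = fun r => G * B.pair r := pair_ofPair _ _ _

theorem factors_mulForm {G : k[X]} (hG : G ≠ 0) (hGd : G.natDegree ≤ d) {B : Frame k m}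
    (hB : BasePointFree m B.pair) : (B.mulForm G hG hGd).Factors G B :=
  ⟨hB, fun r => by rw [pair_mulForm]⟩

theorem Factors.of_center_eq {A A' : Frame k (m + d)} {G : k[X]} {B : Frame k m}
    (h : A.Factors G B) (hc : A.center = A'.center) :
    ∃ B', A'.Factors G B' := by
  obtain ⟨M, hM, hMA⟩ := center_eq_iff.1 hc
  refine ⟨B.act M hM, ?_, fun r => ?_⟩
  · rw [pair_act]
    exact h.basePointFree.pairAct hM
  · rw [hMA, pair_act]
    simp only [pairAct, h.pair_eq]
    ring

theorem center_mem_degreeLocus_iff (hm : 1 ≤ m) {A : Frame k (m + d)} :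
    A.center ∈ degreeLocus k (m + d) m ↔ ∃ G B, A.Factors G B := by
  constructor
  · rintro ⟨A', hc, hA'⟩
    obtain ⟨G, B, h⟩ := exists_factors_of_degree_eq hm hA'
    exact ⟨G, h.of_center_eq hc⟩
  · rintro ⟨G, B, h⟩
    exact ⟨A, rfl, h.degree_eq⟩

theorem Factors.center_mem {A : Frame k (m + d)} {G : k[X]} {B : Frame k m} (h : A.Factors G B) :
    A.center ∈ degreeLocus k (m + d) m := ⟨A, rfl, h.degree_eq⟩

end Frame

/-- The pairs of linear forms defining a member of the degree locus. -/
def toDegreeLocus (k : Type*) [Field k] (n m : ℕ) :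
    Frame.center ⁻¹' degreeLocus k n m → degreeLocus k n m :=
  Set.restrictPreimage _ Frame.center

/-- Openness of `Frame.center` survives restriction to the preimage of any subset. Thus the subspace
topology of the degree locus can be tested on frames. -/
theorem isOpenQuotientMap_toDegreeLocus : IsOpenQuotientMap (toDegreeLocus k n m) where
  surjective := by
    rintro ⟨W, A, rfl, hA⟩
    exact ⟨⟨A, A, rfl, hA⟩, rfl⟩
  continuous := Frame.continuous_center.restrictPreimage
  isOpenMap := Frame.isOpenMap_center.restrictPreimage _

end FrameTopology

/-! ### The map Φ: characterisation, regularity and injectivity. -/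

section Reduction

variable {k : Type*} [Field k] {m d : ℕ}

theorem exists_factors_of_mem (hm : 1 ≤ m) (W : degreeLocus k (m + d) m) :
    ∃ (A : Frame k (m + d)) (G : k[X]) (B : Frame k m), A.center = W.1 ∧ A.Factors G B := by
  obtain ⟨W, A, rfl, hA⟩ := W
  obtain ⟨G, B, h⟩ := Frame.exists_factors_of_degree_eq hm hA
  exact ⟨A, G, B, rfl, h⟩

/-- The center of the base point free part of a pencil of degree `m`. -/
def reducedCenter (hm : 1 ≤ m) (W : degreeLocus k (m + d) m) : Gr k m :=
  (exists_factors_of_mem hm W).choose_spec.choose_spec.choose.center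

theorem reducedCenter_eq (hm : 1 ≤ m) {W : degreeLocus k (m + d) m} {A : Frame k (m + d)}
    {G : k[X]} {B : Frame k m} (hA : A.center = W.1) (h : A.Factors G B) :
    reducedCenter hm W = B.center := by
  obtain ⟨hA', h'⟩ := (exists_factors_of_mem hm W).choose_spec.choose_spec.choose_spec
  exact (h'.unique h (hA'.trans hA.symm)).1

theorem algebraMap_pair_ne_zero {n : ℕ} (A : Frame k n) (r : Fin 2) :
    algebraMap k[X] (RatFunc k) (A.pair r) ≠ 0 := by
  simpa using A.pair_ne_zero r

/-- Once `G` cancels, equality modulo automorphisms says that `B'` has the same ratio as a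
`GL₂`-translate of `B`, and `exists_smul` makes them proportional. Conversely, the reduced pencil
has literally the same projection, so the identity matrix works. -/
theorem sameProjection_iff (hm : 1 ≤ m) (W : degreeLocus k (m + d) m) (V : Gr k m) :
    SameProjection W.1 V ↔ reducedCenter hm W = V := by
  constructor
  · rintro ⟨A, B', hA, rfl, M, hM⟩
    obtain ⟨G, B, h⟩ := (Frame.center_mem_degreeLocus_iff hm).1 (hA ▸ W.2)
    rw [reducedCenter_eq hm hA h]
    have hdet : M.1.det ≠ 0 := (Matrix.GeneralLinearGroup.det M).ne_zero
    have hp : A.projection = algebraMap k[X] (RatFunc k) (B.pair 0) /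
        algebraMap k[X] (RatFunc k) (B.pair 1) := by
      rw [Frame.projection_eq, h.pair_eq, h.pair_eq, map_mul, map_mul, mul_div_mul_left]
      simpa using h.ne_zero
    have hB1 := algebraMap_pair_ne_zero B 1
    have hB'1 := algebraMap_pair_ne_zero B' 1
    have hMB : ∀ r, algebraMap k[X] (RatFunc k) (pairAct M.1 B.pair r) =
        (RatFunc.C (M.1 r 0) * A.projection + RatFunc.C (M.1 r 1)) *
          algebraMap k[X] (RatFunc k) (B.pair 1) := by
      intro r
      rw [hp]
      simp only [pairAct, map_add, map_mul, RatFunc.algebraMap_C]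
      field_simp
    have hMB1 := algebraMap_pair_ne_zero (B.act M.1 hdet) 1
    rw [Frame.pair_act] at hMB1
    have hM' : algebraMap k[X] (RatFunc k) (B'.pair 0) / algebraMap k[X] (RatFunc k) (B'.pair 1) =
        algebraMap k[X] (RatFunc k) (pairAct M.1 B.pair 0) /
          algebraMap k[X] (RatFunc k) (pairAct M.1 B.pair 1) := by
      rw [← Frame.projection_eq, hM, hMB, hMB, mul_div_mul_right _ _ hB1]
    rw [div_eq_div_iff hB'1 hMB1, ← map_mul, ← map_mul] at hM'
    have hcross := RatFunc.algebraMap_injective k hM'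
    obtain ⟨c, hc⟩ := (h.basePointFree.pairAct hdet).exists_smul B'.natDegree_pair_le (by
      linear_combination hcross)
    have hc0 : c ≠ 0 := by
      rintro rfl
      exact B'.pair_ne_zero 0 (by simp [hc])
    refine Frame.center_eq_iff.2 ⟨c • M.1, by simpa [hc0] using hdet, ?_⟩
    ext1 r
    rw [hc]
    simp only [pairAct, Matrix.smul_apply, smul_eq_mul, C_mul]
    ring
  · rintro rfl
    obtain ⟨A, G, B, hA, h⟩ := exists_factors_of_mem hm W
    refine ⟨A, B, hA, (reducedCenter_eq hm hA h).symm, 1, ?_⟩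
    rw [Frame.projection_eq, Frame.projection_eq, h.pair_eq, h.pair_eq, map_mul, map_mul,
      mul_div_mul_left]
    · simp
    · simpa using h.ne_zero

theorem isRegularMap_reducedCenter (hm : 1 ≤ m) :
    IsRegularMap (reducedCenter hm : degreeLocus k (m + d) m → Gr k m) := by
  intro A₀ hA₀
  obtain ⟨G₀, B₀, h₀⟩ := (Frame.center_mem_degreeLocus_iff hm).1 hA₀
  obtain ⟨D, v, hD, hv⟩ := h₀.exists_algebraic_pencil
  refine ⟨D, v, hD, fun A hA hDA => ?_⟩
  obtain ⟨G, B, h⟩ := (Frame.center_mem_degreeLocus_iff hm).1 hA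
  obtain ⟨b, hb, hvb⟩ := hv A G B h hDA
  have hdet : (b • (1 : Matrix (Fin 2) (Fin 2) k)).det ≠ 0 := by simp [hb]
  refine ⟨B.act _ hdet, fun r j => ?_, ?_⟩
  · rw [hvb]
    simp [Frame.act]
  · rw [Frame.center_act]
    exact (reducedCenter_eq hm rfl h).symm

/-- For `d > 0` the pencil spanned by tᵐ and 1 can be multiplied by 1 or by t, giving two points
with the same reduction. For `d = 0` the factor is a constant and the pencil is its own reduction.
-/
theorem injective_reducedCenter_iff (hm : 1 ≤ m) :
    Function.Injective (reducedCenter hm : degreeLocus k (m + d) m → Gr k m) ↔ d = 0 := by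
  constructor
  · intro hinj
    by_contra hd
    have hbpf : BasePointFree m ![(X : k[X]) ^ m, 1] := by
      refine ⟨?_, ?_, 0, ?_⟩
      · rw [Fin.forall_fin_two]
        simp
      · exact isCoprime_one_right
      · simp
    have hli := hbpf.linearIndependent hm
    have hB : BasePointFree m (Frame.ofPair m _ hbpf.natDegree_le hli).pair := by
      rwa [Frame.pair_ofPair]
    have hA := Frame.factors_mulForm (d := d) one_ne_zero (by simp) hB
    have hA' := Frame.factors_mulForm (d := d) X_ne_zero (by rw [natDegree_X]; omega) hB
    have hc : (⟨_, hA.center_mem⟩ : degreeLocus k (m + d) m) = ⟨_, hA'.center_mem⟩ :=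
      hinj ((reducedCenter_eq hm rfl hA).trans (reducedCenter_eq hm rfl hA').symm)
    obtain ⟨-, a, -, ha⟩ := hA.unique hA' (congrArg Subtype.val hc)
    have := congrArg (fun q => coeff q 1) ha
    simp at this
  · rintro rfl W W' hW
    obtain ⟨A, G, B, hA, h⟩ := exists_factors_of_mem hm W
    obtain ⟨A', G', B', hA', h'⟩ := exists_factors_of_mem hm W'
    rw [reducedCenter_eq hm hA h, reducedCenter_eq hm hA' h'] at hW
    apply Subtype.ext
    have aux : ∀ {A : Frame k (m + 0)} {G : k[X]} {B : Frame k m}, A.Factors G B →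
        A.center = B.center := by
      intro A G B h
      have hG := eq_C_of_natDegree_eq_zero (Nat.le_zero.1 h.natDegree_le)
      refine (Frame.center_eq_iff.2 ⟨G.coeff 0 • 1, ?_, ?_⟩).symm
      · have : G.coeff 0 ≠ 0 := fun h0 => h.ne_zero (by rw [hG, h0, C_0])
        simp [this]
      · ext1 r
        refine (h.pair_eq r).trans ?_
        rw [hG]
        fin_cases r <;> simp [pairAct]
    rw [← hA, ← hA', aux h, aux h', hW]

end Reduction
end

noncomputable section

open Polynomial Topology TopologicalSpace

/-! ### Coordinates (G, B) of a pencil and their normal form. -/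

section Coordinates

variable {k : Type*} [Field k] {m d : ℕ}

/-- The indices of the coefficients of a form of degree `d` and of a pair of forms of degree `m`. -/
abbrev PencilIndex (d m : ℕ) : Type := Fin (d + 1) ⊕ Fin 2 × Fin (m + 1)

/-- The form of degree `d` with given coefficients. -/
def baseForm (x : PencilIndex d m → k) : k[X] := formPoly d fun i => x (Sum.inl i)

/-- The pair of forms of degree `m` with given coefficients. -/
def basePair (x : PencilIndex d m → k) (r : Fin 2) : k[X] := formPoly m fun j => x (Sum.inr (r, j))

/-- The coordinates of a nonzero form of degree `d` and a base point free pencil of degree `m`. -/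
def pencilData (k : Type*) [Field k] (d m : ℕ) : Set (PencilIndex d m → k) :=
  {x | baseForm x ≠ 0 ∧ BasePointFree m (basePair x)}

/-- The frame of the base point free pencil with given coordinates. -/
def reducedFrame (hm : 1 ≤ m) {x : PencilIndex d m → k} (hx : x ∈ pencilData k d m) : Frame k m :=
  ⟨fun r j => x (Sum.inr (r, j)), LinearIndependent.of_comp (formPoly m) (hx.2.linearIndependent hm)⟩

theorem pair_reducedFrame (hm : 1 ≤ m) {x : PencilIndex d m → k} (hx : x ∈ pencilData k d m) :
    (reducedFrame hm hx).pair = basePair x := rfl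

/-- The frame of the pencil with given coordinates. -/
def pencilFrame (hm : 1 ≤ m) {x : PencilIndex d m → k} (hx : x ∈ pencilData k d m) :
    Frame k (m + d) :=
  (reducedFrame hm hx).mulForm (baseForm x) hx.1 (natDegree_formPoly_le _)

theorem factors_pencilFrame (hm : 1 ≤ m) {x : PencilIndex d m → k} (hx : x ∈ pencilData k d m) :
    (pencilFrame hm hx).Factors (baseForm x) (reducedFrame hm hx) :=
  Frame.factors_mulForm _ _ hx.2

/-- The member of the degree locus with given coordinates. -/
def ofPencilData (hm : 1 ≤ m) (x : pencilData k d m) : degreeLocus k (m + d) m :=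
  ⟨(pencilFrame hm x.2).center, (factors_pencilFrame hm x.2).center_mem⟩

theorem reducedCenter_ofPencilData (hm : 1 ≤ m) (x : pencilData k d m) :
    reducedCenter hm (ofPencilData hm x) = (reducedFrame hm x.2).center :=
  reducedCenter_eq hm rfl (factors_pencilFrame hm x.2)

/-- Two systems of coordinates of the same pencil: they differ by a scalar on the form of degree `d`
and by an invertible matrix on the pair of forms of degree `m`. -/
def SamePencil (x y : PencilIndex d m → k) : Prop :=
  ∃ (a : k) (M : Matrix (Fin 2) (Fin 2) k), a ≠ 0 ∧ M.det ≠ 0 ∧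
    (∀ i, y (Sum.inl i) = a * x (Sum.inl i)) ∧
    ∀ r j, y (Sum.inr (r, j)) = M r 0 * x (Sum.inr (0, j)) + M r 1 * x (Sum.inr (1, j))

namespace SamePencil

variable {x y : PencilIndex d m → k}

theorem baseForm_eq {a : k} (h : ∀ i, y (Sum.inl i) = a * x (Sum.inl i)) :
    baseForm y = C a * baseForm x := by
  rw [baseForm, baseForm, ← smul_eq_C_mul, ← map_smul]
  congr 1
  ext i
  exact h i

theorem basePair_eq {M : Matrix (Fin 2) (Fin 2) k}
    (h : ∀ r j, y (Sum.inr (r, j)) = M r 0 * x (Sum.inr (0, j)) + M r 1 * x (Sum.inr (1, j))) :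
    basePair y = pairAct M (basePair x) := by
  ext1 r
  rw [pairAct, basePair, basePair, basePair, ← smul_eq_C_mul, ← smul_eq_C_mul, ← map_smul,
    ← map_smul, ← map_add]
  congr 1
  ext j
  exact h r j

theorem mem (h : SamePencil x y) (hx : x ∈ pencilData k d m) : y ∈ pencilData k d m := by
  obtain ⟨a, M, ha, hM, h1, h2⟩ := h
  refine ⟨?_, ?_⟩
  · rw [baseForm_eq h1]
    exact mul_ne_zero (C_ne_zero.2 ha) hx.1
  · rw [basePair_eq h2]
    exact hx.2.pairAct hM

theorem ofPencilData_eq (hm : 1 ≤ m) {x y : pencilData k d m} (h : SamePencil x.1 y.1) :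
    ofPencilData hm x = ofPencilData hm y := by
  obtain ⟨a, M, ha, hM, h1, h2⟩ := h
  refine Subtype.ext (Frame.center_eq_iff.2 ⟨a • M, by simp [ha, hM], ?_⟩)
  ext1 r
  rw [(factors_pencilFrame hm y.2).pair_eq, pair_reducedFrame, basePair_eq h2, baseForm_eq h1]
  simp only [pairAct, (factors_pencilFrame hm x.2).pair_eq, pair_reducedFrame, Matrix.smul_apply,
    smul_eq_mul, C_mul]
  ring

theorem of_ofPencilData_eq (hm : 1 ≤ m) {x y : pencilData k d m}
    (h : ofPencilData hm x = ofPencilData hm y) : SamePencil x.1 y.1 := by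
  obtain ⟨hc, a, ha, hG⟩ := (factors_pencilFrame hm x.2).unique (factors_pencilFrame hm y.2)
    (congrArg Subtype.val h)
  obtain ⟨M, hM, hMB⟩ := Frame.exists_eq_mul_of_center_eq hc
  refine ⟨a, M, ha, hM, fun i => ?_, fun r j => ?_⟩
  · have : (fun i => y.1 (Sum.inl i)) = a • fun i => x.1 (Sum.inl i) := by
      apply formPoly_injective d
      rw [map_smul, smul_eq_C_mul]
      exact hG
    exact congrFun this i
  · have := congrFun (congrFun hMB r) j
    rw [Matrix.mul_apply, Fin.sum_univ_two] at this
    exact this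

end SamePencil

theorem exists_ofPencilData_eq_of_factors (hm : 1 ≤ m) {A : Frame k (m + d)} {G : k[X]}
    {B : Frame k m} (h : A.Factors G B) :
    ∃ hx : (Sum.elim (polyForm d G) fun p => B.1 p.1 p.2 : PencilIndex d m → k) ∈ pencilData k d m,
      (ofPencilData hm ⟨_, hx⟩).1 = A.center := by
  have hG : baseForm (Sum.elim (polyForm d G) fun p => B.1 p.1 p.2 : PencilIndex d m → k) = G :=
    formPoly_polyForm h.natDegree_le
  have hx : (Sum.elim (polyForm d G) fun p => B.1 p.1 p.2 : PencilIndex d m → k) ∈ pencilData k d m :=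
    ⟨ne_of_eq_of_ne hG h.ne_zero, h.basePointFree⟩
  refine ⟨hx, congrArg Frame.center (Frame.pair_injective (funext fun r => ?_))⟩
  rw [(factors_pencilFrame hm hx).pair_eq, hG, h.pair_eq]
  rfl

theorem ofPencilData_surjective (hm : 1 ≤ m) :
    Function.Surjective (ofPencilData hm : pencilData k d m → degreeLocus k (m + d) m) := by
  intro W
  obtain ⟨A, G, B, hA, h⟩ := exists_factors_of_mem hm W
  obtain ⟨hx, hW⟩ := exists_ofPencilData_eq_of_factors hm h
  exact ⟨⟨_, hx⟩, Subtype.ext (hW.trans hA)⟩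

/-- The minor of the pair of forms in the columns `j` and `l`. -/
def pairMinor {R : Type*} [CommRing R] (j l : Fin (m + 1)) (x : PencilIndex d m → R) : R :=
  x (Sum.inr (0, j)) * x (Sum.inr (1, l)) - x (Sum.inr (0, l)) * x (Sum.inr (1, j))

/-- The coordinates normalised at the `i`-th coefficient of the form of degree `d` and at the columns
`j` and `l` of the pair of forms of degree `m`. -/
def normalizeAt (i : Fin (d + 1)) (j l : Fin (m + 1)) (x : PencilIndex d m → k) :
    PencilIndex d m → k :=
  Sum.elim (fun a => x (Sum.inl a) / x (Sum.inl i)) fun p =>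
    ![x (Sum.inr (1, l)) * x (Sum.inr (0, p.2)) - x (Sum.inr (0, l)) * x (Sum.inr (1, p.2)),
      x (Sum.inr (0, j)) * x (Sum.inr (1, p.2)) - x (Sum.inr (1, j)) * x (Sum.inr (0, p.2))] p.1 /
      pairMinor j l x

/-- The coordinates that can be normalised. -/
def Normalizable (i : Fin (d + 1)) (j l : Fin (m + 1)) (x : PencilIndex d m → k) : Prop :=
  x (Sum.inl i) ≠ 0 ∧ pairMinor j l x ≠ 0

/-- The normalised coordinates. -/
def IsNormalized (i : Fin (d + 1)) (j l : Fin (m + 1)) (x : PencilIndex d m → k) : Prop :=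
  x (Sum.inl i) = 1 ∧ x (Sum.inr (0, j)) = 1 ∧ x (Sum.inr (1, l)) = 1 ∧ x (Sum.inr (0, l)) = 0 ∧
    x (Sum.inr (1, j)) = 0

section

variable {i : Fin (d + 1)} {j l : Fin (m + 1)} {x y : PencilIndex d m → k}

theorem SamePencil.pairMinor_eq {M : Matrix (Fin 2) (Fin 2) k}
    (h : ∀ r j, y (Sum.inr (r, j)) = M r 0 * x (Sum.inr (0, j)) + M r 1 * x (Sum.inr (1, j))) :
    pairMinor j l y = M.det * pairMinor j l x := by
  simp only [pairMinor, h, Matrix.det_fin_two]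
  ring

theorem SamePencil.pairMinor_ne_zero_iff (h : SamePencil x y) :
    pairMinor j l y ≠ 0 ↔ pairMinor j l x ≠ 0 := by
  obtain ⟨a, M, ha, hM, h1, h2⟩ := h
  simp [SamePencil.pairMinor_eq h2, hM]

theorem SamePencil.normalizable_iff (h : SamePencil x y) :
    Normalizable i j l y ↔ Normalizable i j l x := by
  refine and_congr ?_ h.pairMinor_ne_zero_iff
  obtain ⟨a, M, ha, hM, h1, h2⟩ := h
  simp [h1, ha]

/-- The numerators on the pair coordinates are themselves 2 × 2 minors, so they scale by the same
determinant as the denominator. This makes the charts well defined. -/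
theorem SamePencil.normalize_eq (h : SamePencil x y) : normalizeAt i j l y = normalizeAt i j l x := by
  obtain ⟨a, M, ha, hM, h1, h2⟩ := h
  ext (b | ⟨r, c⟩)
  · simp only [normalizeAt, Sum.elim_inl, h1]
    exact mul_div_mul_left _ _ ha
  · simp only [normalizeAt, Sum.elim_inr, SamePencil.pairMinor_eq h2]
    rw [← mul_div_mul_left _ (pairMinor j l x) hM]
    congr 1
    rw [Matrix.det_fin_two]
    fin_cases r <;> simp only [h2, Fin.zero_eta, Fin.mk_one, Matrix.cons_val_zero,
      Matrix.cons_val_one] <;> ring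

theorem Normalizable.samePencil (h : Normalizable i j l x) : SamePencil x (normalizeAt i j l x) := by
  have hmin := h.2
  -- The matrix is the inverse of the 2 × 2 block of the pair in the columns `j` and `l`.
  refine ⟨(x (Sum.inl i))⁻¹, (pairMinor j l x)⁻¹ • !![x (Sum.inr (1, l)), -x (Sum.inr (0, l));
    -x (Sum.inr (1, j)), x (Sum.inr (0, j))], inv_ne_zero h.1, ?_, fun b => ?_, fun r c => ?_⟩
  · rw [Matrix.det_smul, Matrix.det_fin_two_of]
    refine mul_ne_zero (pow_ne_zero _ (inv_ne_zero hmin)) ?_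
    convert hmin using 1
    rw [pairMinor]
    ring
  · simp only [normalizeAt, Sum.elim_inl]
    rw [div_eq_inv_mul]
  · simp only [normalizeAt, Sum.elim_inr]
    fin_cases r <;> simp [div_eq_inv_mul] <;> ring

theorem Normalizable.isNormalized (h : Normalizable i j l x) :
    IsNormalized i j l (normalizeAt i j l x) := by
  have hmin := h.2
  refine ⟨div_self h.1, (div_eq_one_iff_eq hmin).2 ?_, (div_eq_one_iff_eq hmin).2 ?_,
    div_eq_zero_iff.2 (Or.inl ?_), div_eq_zero_iff.2 (Or.inl ?_)⟩ <;>
  simp [pairMinor, mul_comm]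

theorem IsNormalized.normalizable (h : IsNormalized i j l x) : Normalizable i j l x := by
  obtain ⟨h1, h2, h3, h4, h5⟩ := h
  simp [Normalizable, pairMinor, h1, h2, h3, h4]

theorem IsNormalized.normalize_eq (h : IsNormalized i j l x) : normalizeAt i j l x = x := by
  obtain ⟨h1, h2, h3, h4, h5⟩ := h
  ext (b | ⟨r, c⟩)
  · simp [normalizeAt, h1]
  · fin_cases r <;> simp [normalizeAt, pairMinor, h2, h3, h4, h5]

theorem exists_baseForm_coord_ne_zero (hx : x ∈ pencilData k d m) : ∃ i, x (Sum.inl i) ≠ 0 := by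
  by_contra! h
  apply hx.1
  rw [baseForm, show (fun i => x (Sum.inl i)) = 0 from funext h, map_zero]

theorem exists_pairMinor_ne_zero (hm : 1 ≤ m) (hx : x ∈ pencilData k d m) :
    ∃ j l, pairMinor j l x ≠ 0 := by
  by_contra! h
  have hli := (reducedFrame hm hx).2
  obtain ⟨j, hj⟩ := Function.ne_iff.1 (hli.ne_zero 0)
  have := (linearIndependent_fin_two_iff.1 hli) (x (Sum.inr (1, j))) (-x (Sum.inr (0, j))) (by
    ext l
    have := h j l
    simp only [pairMinor] at this
    simp only [reducedFrame, Matrix.row, Pi.add_apply, Pi.smul_apply, smul_eq_mul, Pi.zero_apply]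
    linear_combination -this)
  exact hj (neg_eq_zero.1 this.2)

end

end Coordinates
end

noncomputable section

open Polynomial Topology TopologicalSpace

/-! ### Charts of the degree locus are homeomorphisms onto their images. -/

section Charts

attribute [local instance] zariskiTopology

variable {k : Type*} [Field k] {m d : ℕ}

theorem continuous_ofPencilData (hm : 1 ≤ m) :
    Continuous (ofPencilData hm : pencilData k d m → degreeLocus k (m + d) m) := by
  refine Continuous.subtype_mk (Frame.continuous_center.comp ?_) _
  rw [Frame.isInducing_coeffs.continuous_iff]
  -- Multiplying the generic forms expresses the coefficients of G·B as polynomials in the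
  -- coordinates.
  refine continuous_of_polynomial continuous_subtype_val _ (fun t => polyForm (m + d)
    (formPoly d (fun i => MvPolynomial.X (Sum.inl i)) *
      formPoly m fun j => MvPolynomial.X (Sum.inr (t.1, j))) t.2) fun x t => ?_
  have h1 : ∀ r, (pencilFrame hm x.2).1 r = polyForm (m + d) (baseForm x.1 * basePair x.1 r) := by
    intro r
    rw [← pair_reducedFrame hm x.2, ← (factors_pencilFrame hm x.2).pair_eq]
    exact (polyForm_formPoly _).symm
  rw [Function.comp_apply, Frame.coeffs, h1, polyForm, polyForm, ← coeff_map, Polynomial.map_mul,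
    map_formPoly, map_formPoly]
  simp [baseForm, basePair]

/-- Coordinates of a member of the degree locus. -/
def coordsOf (hm : 1 ≤ m) (W : degreeLocus k (m + d) m) : pencilData k d m :=
  (ofPencilData_surjective hm W).choose

theorem ofPencilData_coordsOf (hm : 1 ≤ m) (W : degreeLocus k (m + d) m) :
    ofPencilData hm (coordsOf hm W) = W := (ofPencilData_surjective hm W).choose_spec

theorem samePencil_coordsOf (hm : 1 ≤ m) (x : pencilData k d m) :
    SamePencil x.1 (coordsOf hm (ofPencilData hm x)).1 :=
  SamePencil.of_ofPencilData_eq hm (ofPencilData_coordsOf hm _).symm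

/-- The affine charts of the degree locus. -/
def chart (hm : 1 ≤ m) (i : Fin (d + 1)) (j l : Fin (m + 1)) (W : degreeLocus k (m + d) m) :
    PencilIndex d m → k := normalizeAt i j l (coordsOf hm W).1

/-- The domains of the affine charts of the degree locus. -/
def chartDomain (k : Type*) [Field k] (hm : 1 ≤ m) (i : Fin (d + 1)) (j l : Fin (m + 1)) :
    Set (degreeLocus k (m + d) m) :=
  {W | Normalizable i j l (coordsOf hm W).1}

section

variable {hm : 1 ≤ m} {i : Fin (d + 1)} {j l : Fin (m + 1)}

theorem chart_ofPencilData (x : pencilData k d m) :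
    chart hm i j l (ofPencilData hm x) = normalizeAt i j l x.1 :=
  (samePencil_coordsOf hm x).normalize_eq

theorem ofPencilData_mem_chartDomain {x : pencilData k d m} :
    ofPencilData hm x ∈ chartDomain k hm i j l ↔ Normalizable i j l x.1 :=
  (samePencil_coordsOf hm x).normalizable_iff

theorem chart_mem {W : degreeLocus k (m + d) m} (hW : W ∈ chartDomain k hm i j l) :
    chart hm i j l W ∈ pencilData k d m :=
  (Normalizable.samePencil hW).mem (coordsOf hm W).2

theorem ofPencilData_chart {W : degreeLocus k (m + d) m} (hW : W ∈ chartDomain k hm i j l) :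
    ofPencilData hm ⟨chart hm i j l W, chart_mem hW⟩ = W := by
  conv_rhs => rw [← ofPencilData_coordsOf hm W]
  exact (SamePencil.ofPencilData_eq hm (y := ⟨chart hm i j l W, chart_mem hW⟩)
    (Normalizable.samePencil hW)).symm

end

/-- Near each frame, (G, B) can be chosen polynomially in the frame. The chart need not see this
choice, since the remaining ambiguity is absorbed by `SamePencil`. -/
theorem exists_algebraic_coords (hm : 1 ≤ m)
    (A₀ : Frame.center ⁻¹' degreeLocus k (m + d) m) :
    ∃ (D : MvPolynomial (Fin 2 × Fin (m + d + 1)) k)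
      (y : PencilIndex d m → MvPolynomial (Fin 2 × Fin (m + d + 1)) k),
      MvPolynomial.eval A₀.1.coeffs D ≠ 0 ∧ ∀ A : Frame.center ⁻¹' degreeLocus k (m + d) m,
        MvPolynomial.eval A.1.coeffs D ≠ 0 →
        ∃ h : (fun t => MvPolynomial.eval A.1.coeffs (y t)) ∈ pencilData k d m,
          ofPencilData hm ⟨_, h⟩ = toDegreeLocus k (m + d) m A := by
  obtain ⟨G₀, B₀, h₀⟩ := (Frame.center_mem_degreeLocus_iff hm).1 A₀.2
  obtain ⟨D, g, v, hD, hv⟩ := h₀.exists_algebraic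
  refine ⟨D, Sum.elim g fun p => v p.1 p.2, hD, fun A hA => ?_⟩
  obtain ⟨G, B, h⟩ := (Frame.center_mem_degreeLocus_iff hm).1 A.2
  obtain ⟨a, b, ha, hb, hga, hvb⟩ := hv A.1 G B h hA
  obtain ⟨hx, hW⟩ := exists_ofPencilData_eq_of_factors hm h
  have hsame : SamePencil (Sum.elim (polyForm d G) fun p => B.1 p.1 p.2 : PencilIndex d m → k)
      fun t => MvPolynomial.eval A.1.coeffs ((Sum.elim g fun p => v p.1 p.2) t) :=
    ⟨a, b • 1, ha, by simp [hb], hga, fun r j => by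
      refine (hvb r j).trans ?_
      fin_cases r <;> simp⟩
  refine ⟨hsame.mem hx, ?_⟩
  rw [← SamePencil.ofPencilData_eq hm (x := ⟨_, hx⟩) (y := ⟨_, hsame.mem hx⟩) hsame]
  exact Subtype.ext hW

section

variable (hm : 1 ≤ m) (i : Fin (d + 1)) (j l : Fin (m + 1))

theorem exists_local_chart {A₀ : Frame.center ⁻¹' degreeLocus k (m + d) m}
    (hA₀ : toDegreeLocus k (m + d) m A₀ ∈ chartDomain k hm i j l) :
    ∃ U : Set (Frame.center ⁻¹' degreeLocus k (m + d) m), IsOpen U ∧ A₀ ∈ U ∧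
      (∀ A ∈ U, toDegreeLocus k (m + d) m A ∈ chartDomain k hm i j l) ∧
      ContinuousOn (chart hm i j l ∘ toDegreeLocus k (m + d) m) U := by
  obtain ⟨D, y, hD, hy⟩ := exists_algebraic_coords hm A₀
  -- The extra factors are the denominators of the normalisation, so nonvanishing means both that
  -- coordinates are available and that they can be normalised.
  let D' := D * (y (Sum.inl i) * pairMinor j l y)
  have hD' : ∀ A : Frame.center ⁻¹' degreeLocus k (m + d) m,
      MvPolynomial.eval A.1.coeffs D' ≠ 0 ↔ MvPolynomial.eval A.1.coeffs D ≠ 0 ∧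
        Normalizable i j l fun t => MvPolynomial.eval A.1.coeffs (y t) := by
    intro A
    simp only [D', Normalizable, pairMinor, map_mul, map_sub, ne_eq, mul_eq_zero, not_or]
  have hcont : Continuous fun A : Frame.center ⁻¹' degreeLocus k (m + d) m => A.1.coeffs :=
    Frame.continuous_coeffs.comp continuous_subtype_val
  refine ⟨{A | MvPolynomial.eval A.1.coeffs D' ≠ 0}, (isOpen_eval_ne_zero D').preimage hcont,
    ?_, fun A hA => ?_, ?_⟩
  · obtain ⟨h, hW⟩ := hy A₀ hD
    rw [← hW] at hA₀
    exact (hD' A₀).2 ⟨hD, ofPencilData_mem_chartDomain.1 hA₀⟩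
  · obtain ⟨h1, h2⟩ := (hD' A).1 hA
    obtain ⟨h, hW⟩ := hy A h1
    rw [← hW]
    exact ofPencilData_mem_chartDomain.2 h2
  · rw [continuousOn_iff_continuous_domRestrict]
    let P : PencilIndex d m → MvPolynomial (Fin 2 × Fin (m + d + 1)) k :=
      Sum.elim (fun a => y (Sum.inl a)) fun p =>
        ![y (Sum.inr (1, l)) * y (Sum.inr (0, p.2)) - y (Sum.inr (0, l)) * y (Sum.inr (1, p.2)),
          y (Sum.inr (0, j)) * y (Sum.inr (1, p.2)) - y (Sum.inr (1, j)) * y (Sum.inr (0, p.2))] p.1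
    let Q : PencilIndex d m → MvPolynomial (Fin 2 × Fin (m + d + 1)) k :=
      Sum.elim (fun _ => y (Sum.inl i)) fun _ => pairMinor j l y
    refine continuous_of_rational (hcont.comp continuous_subtype_val) _ fun t => ⟨P t, Q t, ?_⟩
    rintro ⟨A, hA⟩
    obtain ⟨h1, h2⟩ := (hD' A).1 hA
    obtain ⟨h, hW⟩ := hy A h1
    simp only [Function.comp_apply, Set.domRestrict_apply, ← hW, chart_ofPencilData]
    rcases t with a | ⟨r, c⟩
    · refine ⟨h2.1, ?_⟩
      simp only [normalizeAt, Sum.elim_inl, P, Q]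
      exact div_mul_cancel₀ _ h2.1
    · have hmin : MvPolynomial.eval A.1.coeffs (pairMinor j l y) =
          pairMinor j l fun t => MvPolynomial.eval A.1.coeffs (y t) := by
        simp [pairMinor]
      simp only [normalizeAt, Sum.elim_inr, P, Q, hmin]
      refine ⟨h2.2, ?_⟩
      rw [div_mul_cancel₀ _ h2.2]
      fin_cases r <;> simp

theorem isOpen_chartDomain : IsOpen (chartDomain k hm i j l) := by
  rw [← isOpenQuotientMap_toDegreeLocus.isQuotientMap.isOpen_preimage, isOpen_iff_forall_mem_open]
  intro A₀ hA₀
  obtain ⟨U, hU, hA₀U, hUd, -⟩ := exists_local_chart hm i j l hA₀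
  exact ⟨U, hUd, hU, hA₀U⟩

theorem continuousOn_chart : ContinuousOn (chart hm i j l) (chartDomain k hm i j l) := by
  intro W hW
  obtain ⟨A₀, rfl⟩ := isOpenQuotientMap_toDegreeLocus.surjective W
  obtain ⟨U, hU, hA₀U, -, hUc⟩ := exists_local_chart hm i j l hW
  refine ContinuousAt.continuousWithinAt ?_
  rw [← isOpenQuotientMap_toDegreeLocus.continuousAt_comp_iff]
  exact hUc.continuousAt (hU.mem_nhds hA₀U)

/-- The inverse of the chart is the multiplication map `ofPencilData`, which is continuous, so a
chart restricts to a homeomorphism on any subset of its domain. -/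
theorem topologicalKrullDim_chart_image {H : Set (degreeLocus k (m + d) m)}
    (hH : H ⊆ chartDomain k hm i j l) :
    topologicalKrullDim H = topologicalKrullDim (chart hm i j l '' H) := by
  have hmem : ∀ x ∈ chart hm i j l '' H, x ∈ pencilData k d m := by
    rintro _ ⟨W, hW, rfl⟩
    exact chart_mem (hH hW)
  have hinv : ∀ x : chart hm i j l '' H, ofPencilData hm ⟨x, hmem x x.2⟩ ∈ H := by
    rintro ⟨_, W, hW, rfl⟩
    simpa only [ofPencilData_chart (hH hW)] using hW
  let e : H ≃ₜ chart hm i j l '' H :=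
    { toFun := fun W => ⟨chart hm i j l W, Set.mem_image_of_mem _ W.2⟩
      invFun := fun x => ⟨ofPencilData hm ⟨x, hmem x x.2⟩, hinv x⟩
      left_inv := fun W => Subtype.ext (ofPencilData_chart (hH W.2))
      right_inv := by
        rintro ⟨_, W, hW, rfl⟩
        exact Subtype.ext (congrArg (chart hm i j l) (ofPencilData_chart (hH hW)))
      continuous_toFun := Continuous.subtype_mk
        (continuousOn_iff_continuous_domRestrict.1 ((continuousOn_chart hm i j l).mono hH)) _
      continuous_invFun := Continuous.subtype_mk ((continuous_ofPencilData hm).comp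
        (Continuous.subtype_mk continuous_subtype_val fun x => hmem x x.2)) hinv }
  exact e.isHomeomorph.topologicalKrullDim_eq

end

end Charts
end

noncomputable section

open Polynomial Topology TopologicalSpace

/-! ### Dimension of the degree locus. -/

section DimensionOfDegreeLocus

attribute [local instance] zariskiTopology

variable {k : Type*} [Field k] {m d : ℕ}

theorem topologicalKrullDim_le_of_inter_le {X : Type*} [TopologicalSpace X] {H : Set X}
    {D : WithBot ℕ∞}
    (h : ∀ x ∈ H, ∃ U : Set X, IsOpen U ∧ x ∈ U ∧ topologicalKrullDim ↥(H ∩ U) ≤ D) :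
    topologicalKrullDim H ≤ D := by
  refine topologicalKrullDim_le_of_open_cover fun x => ?_
  obtain ⟨U, hU, hxU, hD⟩ := h x.1 x.2
  refine ⟨Subtype.val ⁻¹' U, hU.preimage continuous_subtype_val, hxU, ?_⟩
  let f : (Subtype.val ⁻¹' U : Set H) → ↥(H ∩ U) := fun y => ⟨y.1.1, y.1.2, y.2⟩
  have hf : IsInducing f := by
    refine IsInducing.of_comp (g := Subtype.val)
      (Continuous.subtype_mk (continuous_subtype_val.comp continuous_subtype_val) _)
      continuous_subtype_val ?_
    exact (IsInducing.subtypeVal (t := H)).comp (IsInducing.subtypeVal (t := Subtype.val ⁻¹' U))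
  exact hf.topologicalKrullDim_le.trans hD

theorem topologicalKrullDim_mono {X : Type*} [TopologicalSpace X] {s t : Set X} (h : s ⊆ t) :
    topologicalKrullDim s ≤ topologicalKrullDim t :=
  (IsEmbedding.inclusion h).isInducing.topologicalKrullDim_le

theorem topologicalKrullDim_univ (X : Type*) [TopologicalSpace X] :
    topologicalKrullDim (Set.univ : Set X) = topologicalKrullDim X :=
  (Homeomorph.Set.univ X).isHomeomorph.topologicalKrullDim_eq

theorem isOpen_basePointFree (hm : 1 ≤ m) :
    IsOpen {x : PencilIndex d m → k | BasePointFree m (basePair x)} := by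
  let R : MvPolynomial (PencilIndex d m) k :=
    resultant (formPoly m fun j => MvPolynomial.X (Sum.inr (0, j)))
      (formPoly m fun j => MvPolynomial.X (Sum.inr (1, j))) m m
  have hmap : ∀ (x : PencilIndex d m → k) (r : Fin 2),
      (formPoly m fun j => (MvPolynomial.X (Sum.inr (r, j)) : MvPolynomial (PencilIndex d m) k)).map
        (MvPolynomial.eval x) = basePair x r := by
    intro x r
    rw [map_formPoly, basePair]
    congr 1
    ext j
    exact MvPolynomial.eval_X _
  convert isOpen_eval_ne_zero R using 1
  ext x
  rw [Set.mem_ofPred_eq, Set.mem_ofPred_eq, ← resultant_map_map, hmap, hmap]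
  exact BasePointFree.iff_resultant hm fun r => natDegree_formPoly_le _

section

variable (hm : 1 ≤ m) (i : Fin (d + 1)) {j l : Fin (m + 1)}

/-- A point with normalised coordinates. -/
def normalPoint (k : Type*) [Field k] (i : Fin (d + 1)) (j l : Fin (m + 1)) :
    PencilIndex d m → k :=
  fun t => if t = Sum.inl i ∨ t = Sum.inr (0, j) ∨ t = Sum.inr (1, l) then 1 else 0

/-- The coordinates that are fixed by the normalisation. -/
def fixedCoords (i : Fin (d + 1)) (j l : Fin (m + 1)) : Finset (PencilIndex d m) :=
  {Sum.inl i, Sum.inr (0, j), Sum.inr (1, l), Sum.inr (0, l), Sum.inr (1, j)}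

/-- Of the (d + 1) + 2(m + 1) coordinates, one of G and four of B are fixed, and these five are
distinct because `j ≠ l`. -/
theorem card_compl_fixedCoords (hm : 1 ≤ m) (hjl : j ≠ l) :
    (fixedCoords i j l)ᶜ.card = m + d + m - 2 := by
  rw [Finset.card_compl]
  have : (fixedCoords i j l).card = 5 := by
    simp [fixedCoords, Finset.card_insert_of_notMem, hjl, hjl.symm]
  rw [this]
  simp
  omega

theorem chart_image_univ (hjl : j ≠ l) :
    chart hm i j l '' chartDomain k hm i j l =
      coordSlice (fixedCoords i j l)ᶜ (normalPoint k i j l) {x | BasePointFree m (basePair x)} := by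
  ext x
  have hnorm : (∀ c ∉ (fixedCoords i j l)ᶜ, x c = normalPoint k i j l c) ↔ IsNormalized i j l x := by
    simp only [Finset.mem_compl, not_not, fixedCoords, Finset.mem_insert, Finset.mem_singleton,
      forall_eq_or_imp, forall_eq, IsNormalized]
    simp [normalPoint, hjl, hjl.symm]
  rw [coordSlice, Set.mem_ofPred_eq, hnorm]
  constructor
  · rintro ⟨W, hW, rfl⟩
    exact ⟨Normalizable.isNormalized hW, (chart_mem hW).2⟩
  · rintro ⟨hx, hbpf⟩
    have hmem : x ∈ pencilData k d m := by
      -- The form G is automatically nonzero, its `i`-th coefficient being 1; only base point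
      -- freeness cuts out an open condition on the slice.
      refine ⟨fun h0 => ?_, hbpf⟩
      have := congrFun (formPoly_injective d (h0.trans (map_zero _).symm)) i
      exact one_ne_zero (hx.1.symm.trans this)
    refine ⟨ofPencilData hm ⟨x, hmem⟩, ofPencilData_mem_chartDomain.2 hx.normalizable, ?_⟩
    rw [chart_ofPencilData, hx.normalize_eq]

theorem exists_mem_chartDomain (W : degreeLocus k (m + d) m) :
    ∃ i j l, W ∈ chartDomain k hm i j l := by
  obtain ⟨i, hi⟩ := exists_baseForm_coord_ne_zero (coordsOf hm W).2
  obtain ⟨j, l, hjl⟩ := exists_pairMinor_ne_zero hm (coordsOf hm W).2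
  exact ⟨i, j, l, hi, hjl⟩

theorem ne_of_pairMinor_ne_zero {x : PencilIndex d m → k} (h : pairMinor j l x ≠ 0) : j ≠ l := by
  rintro rfl
  exact h (sub_self _)

/-- This point carries the pair (tᵐ, 1). It shows that one chart is nonempty, as the lower bound on
the dimension requires. -/
theorem basePointFree_normalPoint (hm : 1 ≤ m) :
    BasePointFree m (basePair (normalPoint k (0 : Fin (d + 1)) 0 (Fin.last m))) := by
  have hne : (0 : Fin (m + 1)) ≠ Fin.last m := by
    rw [Ne, Fin.ext_iff]
    simp
    omega
  have h0 : basePair (normalPoint k (0 : Fin (d + 1)) 0 (Fin.last m)) 0 = X ^ m := by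
    rw [basePair, formPoly_eq_sum, Finset.sum_eq_single 0]
    · simp [normalPoint]
    · intro j _ hj
      simp [normalPoint, hj]
    · simp
  have h1 : basePair (normalPoint k (0 : Fin (d + 1)) 0 (Fin.last m)) 1 = 1 := by
    rw [basePair, formPoly_eq_sum, Finset.sum_eq_single (Fin.last m)]
    · simp [normalPoint]
    · intro j _ hj
      simp [normalPoint, hj]
    · simp
  refine ⟨fun r => natDegree_formPoly_le _, ?_, 0, ?_⟩
  · rw [h1]
    exact isCoprime_one_right
  · rw [h0]
    simp

theorem topologicalKrullDim_degreeLocus [Infinite k] (hm : 1 ≤ m) :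
    topologicalKrullDim (degreeLocus k (m + d) m) = ((m + d + m - 2 : ℕ) : WithBot ℕ∞) := by
  rw [← topologicalKrullDim_univ]
  refine le_antisymm (topologicalKrullDim_le_of_inter_le fun W _ => ?_) ?_
  · obtain ⟨i, j, l, hW⟩ := exists_mem_chartDomain hm W
    have hjl := ne_of_pairMinor_ne_zero hW.2
    refine ⟨_, isOpen_chartDomain hm i j l, hW, ?_⟩
    rw [Set.univ_inter, topologicalKrullDim_chart_image hm i j l subset_rfl,
      chart_image_univ hm i hjl, ← card_compl_fixedCoords i hm hjl]
    exact topologicalKrullDim_coordSlice_le _ _ _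
  · have hne : (0 : Fin (m + 1)) ≠ Fin.last m := by
      rw [Ne, Fin.ext_iff]
      simp
      omega
    refine le_trans ?_ (topologicalKrullDim_mono (Set.subset_univ (chartDomain k hm 0 0 (Fin.last m))))
    rw [topologicalKrullDim_chart_image hm 0 0 (Fin.last m) subset_rfl, chart_image_univ hm 0 hne,
      ← card_compl_fixedCoords (0 : Fin (d + 1)) hm hne]
    exact le_topologicalKrullDim_coordSlice _ (isOpen_basePointFree hm)
      (basePointFree_normalPoint hm)

end

/-! ### Fibers of Φ as projective spaces of forms of degree d. -/

section Fiber

variable {hm : 1 ≤ m} {x₀ : PencilIndex d m → k}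

/-- The data with the form of degree `d` replaced. -/
def replaceForm (g : Fin (d + 1) → k) (x₀ : PencilIndex d m → k) : PencilIndex d m → k :=
  Sum.elim g fun p => x₀ (Sum.inr p)

theorem replaceForm_mem (hx₀ : x₀ ∈ pencilData k d m) {g : Fin (d + 1) → k} (hg : g ≠ 0) :
    replaceForm g x₀ ∈ pencilData k d m :=
  ⟨fun h => hg (formPoly_injective d (h.trans (map_zero _).symm)), hx₀.2⟩

theorem reducedCenter_replaceForm (hx₀ : x₀ ∈ pencilData k d m) {g : Fin (d + 1) → k} (hg : g ≠ 0) :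
    reducedCenter hm (ofPencilData hm ⟨_, replaceForm_mem hx₀ hg⟩) =
      reducedCenter hm (ofPencilData hm ⟨x₀, hx₀⟩) := by
  rw [reducedCenter_ofPencilData, reducedCenter_ofPencilData]
  rfl

theorem inl_ne_zero {x : PencilIndex d m → k} (hx : x ∈ pencilData k d m) :
    (fun i => x (Sum.inl i)) ≠ 0 := fun h => by
  obtain ⟨i, hi⟩ := exists_baseForm_coord_ne_zero hx
  exact hi (congrFun h i)

/-- Equal reductions differ by an element of `GL₂`, so every point of a fiber can be written with
the pair of `x₀` and only the form G varying. -/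
theorem samePencil_replaceForm (hx₀ : x₀ ∈ pencilData k d m) {x : PencilIndex d m → k}
    (hx : x ∈ pencilData k d m)
    (h : reducedCenter hm (ofPencilData hm ⟨x, hx⟩) = reducedCenter hm (ofPencilData hm ⟨x₀, hx₀⟩)) :
    SamePencil (replaceForm (fun i => x (Sum.inl i)) x₀) x := by
  rw [reducedCenter_ofPencilData, reducedCenter_ofPencilData] at h
  obtain ⟨M, hM, hMB⟩ := Frame.exists_eq_mul_of_center_eq h.symm
  refine ⟨1, M, one_ne_zero, hM, fun i => (one_mul _).symm, fun r j => ?_⟩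
  have := congrFun (congrFun hMB r) j
  rw [Matrix.mul_apply, Fin.sum_univ_two] at this
  exact this

theorem fiber_eq_range (hx₀ : x₀ ∈ pencilData k d m) :
    reducedCenter hm ⁻¹' {reducedCenter hm (ofPencilData hm ⟨x₀, hx₀⟩)} =
      Set.range fun g : {g : Fin (d + 1) → k | g ≠ 0} =>
        ofPencilData hm ⟨_, replaceForm_mem hx₀ g.2⟩ := by
  ext W
  constructor
  · intro hW
    obtain ⟨⟨x, hx⟩, rfl⟩ := ofPencilData_surjective hm W
    exact ⟨⟨_, inl_ne_zero hx⟩, SamePencil.ofPencilData_eq hm (samePencil_replaceForm hx₀ hx hW)⟩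
  · rintro ⟨g, rfl⟩
    exact reducedCenter_replaceForm hx₀ g.2

/-- The fiber is a continuous image of the nonzero vectors of affine (d + 1)-space, an open subset
of an irreducible space. -/
theorem isIrreducible_fiber [Infinite k] (hx₀ : x₀ ∈ pencilData k d m) :
    IsIrreducible (reducedCenter (d := d) hm ⁻¹' {reducedCenter hm (ofPencilData hm ⟨x₀, hx₀⟩)}) := by
  have hopen : IsOpen {g : Fin (d + 1) → k | g ≠ 0} := by
    have : {g : Fin (d + 1) → k | g ≠ 0} =
        ⋃ i, {g | MvPolynomial.eval g (MvPolynomial.X i) ≠ 0} := by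
      ext g
      simp [Function.ne_iff]
    rw [this]
    exact isOpen_iUnion fun i => isOpen_eval_ne_zero _
  have hirr : IsIrreducible (Set.univ : Set {g : Fin (d + 1) → k | g ≠ 0}) := by
    refine isIrreducible_of_image IsInducing.subtypeVal ?_
    rw [Set.image_univ, Subtype.range_coe]
    exact ⟨⟨fun _ => 1, Function.ne_iff.2 ⟨0, one_ne_zero⟩⟩,
      (PreirreducibleSpace.isPreirreducible_univ).open_subset hopen (Set.subset_univ _)⟩
  rw [fiber_eq_range, ← Set.image_univ]
  refine hirr.image _ (Continuous.continuousOn ?_)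
  refine (continuous_ofPencilData hm).comp (Continuous.subtype_mk ?_ _)
  refine continuous_coords continuous_subtype_val _ fun t => ?_
  rcases t with a | p
  · exact Or.inl ⟨a, fun _ => rfl⟩
  · exact Or.inr ⟨x₀ (Sum.inr p), fun _ => rfl⟩

/-- On a fiber the normalised pair is constant, so only the coefficients of G other than the `i`-th
move, and they move freely. The form `Pi.single i 1` serves only to name a base point of this affine
d-space. -/
theorem chart_image_fiber (hx₀ : x₀ ∈ pencilData k d m) (i : Fin (d + 1)) {j l : Fin (m + 1)}
    (hjl : pairMinor j l x₀ ≠ 0) :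
    chart hm i j l '' (reducedCenter (d := d) hm ⁻¹' {reducedCenter hm (ofPencilData hm ⟨x₀, hx₀⟩)} ∩
      chartDomain k hm i j l) =
      coordSlice ((Finset.univ.erase i).map Function.Embedding.inl)
        (normalizeAt i j l (replaceForm (Pi.single i 1) x₀)) Set.univ := by
  have hmin : ∀ g, pairMinor j l (replaceForm g x₀) ≠ 0 := fun _ => hjl
  ext x
  have hcoord : x ∈ coordSlice ((Finset.univ.erase i).map Function.Embedding.inl)
        (normalizeAt i j l (replaceForm (Pi.single i 1) x₀)) Set.univ ↔ x (Sum.inl i) = 1 ∧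
      ∀ p, x (Sum.inr p) = normalizeAt i j l (replaceForm (Pi.single i 1) x₀) (Sum.inr p) := by
    have h1 : normalizeAt i j l (replaceForm (Pi.single i 1) x₀) (Sum.inl i) = 1 := by
      simp [normalizeAt, replaceForm]
    simp [coordSlice, Sum.forall, h1]
  rw [hcoord]
  constructor
  · rintro ⟨W, ⟨hWV, hW⟩, rfl⟩
    refine ⟨(Normalizable.isNormalized hW).1, fun p => ?_⟩
    obtain ⟨⟨y, hy⟩, rfl⟩ := ofPencilData_surjective hm W
    rw [chart_ofPencilData, (samePencil_replaceForm hx₀ hy hWV).normalize_eq]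
    rfl
  · rintro ⟨h1, h2⟩
    have hg : (fun a => x (Sum.inl a)) ≠ 0 := fun h => one_ne_zero (h1.symm.trans (congrFun h i))
    have hn : Normalizable i j l (replaceForm (fun a => x (Sum.inl a)) x₀) := by
      refine ⟨?_, hjl⟩
      change x (Sum.inl i) ≠ 0
      rw [h1]
      exact one_ne_zero
    refine ⟨ofPencilData hm ⟨_, replaceForm_mem hx₀ hg⟩, ⟨reducedCenter_replaceForm hx₀ hg,
      ofPencilData_mem_chartDomain.2 hn⟩, ?_⟩
    rw [chart_ofPencilData]
    ext (a | p)
    · change x (Sum.inl a) / x (Sum.inl i) = _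
      rw [h1, div_one]
    · exact (h2 p).symm

theorem topologicalKrullDim_fiber [Infinite k] (hx₀ : x₀ ∈ pencilData k d m) :
    topologicalKrullDim
      (reducedCenter (d := d) hm ⁻¹' {reducedCenter hm (ofPencilData hm ⟨x₀, hx₀⟩)}) = (d : WithBot ℕ∞) := by
  -- One minor serves the whole fiber, since its nonvanishing is invariant under `GL₂`; the charts
  -- with this `j`, `l` and varying `i` cover it.
  obtain ⟨j, l, hjl⟩ := exists_pairMinor_ne_zero hm hx₀
  have hdim : ∀ i, topologicalKrullDim
      ↥(reducedCenter (d := d) hm ⁻¹' {reducedCenter hm (ofPencilData hm ⟨x₀, hx₀⟩)} ∩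
        chartDomain k hm i j l) = (d : WithBot ℕ∞) := by
    intro i
    rw [topologicalKrullDim_chart_image hm i j l Set.inter_subset_right,
      chart_image_fiber hx₀ i hjl, topologicalKrullDim_coordSlice _ isOpen_univ (Set.mem_univ _)]
    simp
  refine le_antisymm (topologicalKrullDim_le_of_inter_le fun W hW => ?_) ?_
  · obtain ⟨⟨x, hx⟩, rfl⟩ := ofPencilData_surjective hm W
    obtain ⟨i, hi⟩ := exists_baseForm_coord_ne_zero hx
    refine ⟨_, isOpen_chartDomain hm i j l, ofPencilData_mem_chartDomain.2 ⟨hi, ?_⟩, (hdim i).le⟩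
    rw [(samePencil_replaceForm hx₀ hx hW).pairMinor_ne_zero_iff]
    exact hjl
  · exact (hdim 0).symm.le.trans (topologicalKrullDim_mono Set.inter_subset_left)

end Fiber

end DimensionOfDegreeLocus

end

theorem mainTheorem4 {k : Type*} [Field k] [IsAlgClosed k] (n m : ℕ) (hm : 1 ≤ m) (hmn : m ≤ n) :
    ∃ Φ : degreeLocus k n m → Gr k m,
      (∀ (W : degreeLocus k n m) (V : Gr k m), SameProjection W.1 V ↔ Φ W = V) ∧
      IsRegularMap Φ ∧
      (∀ V ∈ Set.range Φ, IsIrreducible (Φ ⁻¹' {V}) ∧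
        topologicalKrullDim (Φ ⁻¹' {V}) = ((n - m : ℕ) : WithBot ℕ∞)) ∧
      (Function.Injective Φ ↔ n = m) ∧
      topologicalKrullDim (degreeLocus k n m) = ((n + m - 2 : ℕ) : WithBot ℕ∞) := by
  obtain ⟨d, rfl⟩ := Nat.exists_eq_add_of_le hmn
  have : Infinite k := IsAlgClosed.instInfinite
  refine ⟨reducedCenter hm, sameProjection_iff hm, isRegularMap_reducedCenter hm, ?_, ?_,
    topologicalKrullDim_degreeLocus hm⟩
  · rintro _ ⟨W, rfl⟩
    obtain ⟨x₀, rfl⟩ := ofPencilData_surjective hm W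
    rw [Nat.add_sub_cancel_left]
    exact ⟨isIrreducible_fiber x₀.2, topologicalKrullDim_fiber x₀.2⟩
  · rw [injective_reducedCenter_iff hm]
    omega
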